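/- **Setting.** There are $n\ge 2$ agents and a public stock $x_t\ge 0$, $t\ge 0$. At time $t$ agent $i$ exerts effort $a^i_t\in[0,1]$ and receives the flow payoff $u(a^i_t,x_t)=b(x_t)-c(a^i_t,x_t)$, where $b(x)=u(0,x)$ and $c(a,x)=u(0,x)-u(a,x)$; payoffs are discounted at rate $1$. Agent $i$ produces increments of the stock at rate $\lambda a^i_t$, with $\lambda>0$; the sizes $\tilde z$ of the increments are drawn from a distribution $F$ on $(0,\infty)$ with finite mean $\mu$, and the production and the sizes of increments are independent across agents, time, and from each other. Assume that $u:[0,1]\times\mathbb R_+\to\mathbb R$ is twice continuously differentiable, and increasing and concave in $x$; that $c(a,x)$ is increasing and convex in $a$, and strictly increasing in $a$ if $x>0$; that $c_1(a,x)$ and $c_{11}(a,x)$ (the first two partial derivatives in $a$) are increasing in $x$; and that $\lim_{x\to\infty}\{\lambda\mu n b'(x)-c_1(a,x)\}<0$ for all $0<a\le 1$ (the limit may be $-\infty$). "Increasing" and "concave" are meant weakly. A strategy assigns to each public history (the initial stock and the times, sizes and producers of the past increments) a measurable effort schedule to be followed until the next increment; a Markov strategy is a Borel map $\alpha:\mathbb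 R_+\to[0,1]$, with $a^i_t=\alpha(x_t)$. Welfare is the average across agents of the expected discounted payoffs, and $v_*(x_0)$ is the supremum of welfare over all strategy profiles when the initial stock is $x_0$. **Statement.** There is a Markov strategy $\alpha_*$ (the *efficient effort*) that, if played by all agents, attains the maximal welfare $v_*(x_0)$ for every $x_0\ge 0$, and such that, for each $x\ge 0$, $\alpha_*(x)$ is the smallest maximiser over $a\in[0,1]$ of $a\lambda n\{\mathbb E_F[v_*(x+\tilde z)]-v_*(x)\}-c(a,x)$. Let $(\tilde x_t)_{t\ge 0}$ be the (right-continuous) stock process when all agents play $\alpha_*$ from the initial stock $x_0\ge 0$, and consider the inequality $$\lambda n\{\mathbb E_F[b(x+\tilde z)]-b(x)\}\le c_1(0,x),\qquad x\ge 0. \tag{1}$$ 1. If (1) has a solution, then it has a smallest solution $x_*$, and $\alpha_*(x)=0$ for all $x\ge x_*$. If $x_0\ge x_*$, then a.s. no effort is exerted: $\alpha_*(\tilde x_t)=0$ for all $t\ge 0$. If $x_0<x_*$, then a.s. there is a first time $\tau<\infty$ at which $\tilde x_\tau\ge x_*$, and $\alpha_*(\tilde x_t)>0$ for all $0\le t<\tau$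 whereas $\alpha_*(\tilde x_t)=0$ for all $t\ge\tau$. 2. If (1) holds with $>$ in place of $\le$ for all $x\ge 0$, then, for every $x_0\ge 0$, a.s. $\alpha_*(\tilde x_t)>0$ for all $t\ge 0$, and $\tilde x_t\to\infty$ as $t\to\infty$. -/

import Mathlib

open Set Filter Topology MeasureTheory ProbabilityTheory

namespace InnovationGame

noncomputable section

/-! ### Primitives

`n` agents; flow payoff `u a x` of effort `a ∈ [0,1]` when the stock is `x ≥ 0`; rate `lam` at which
a unit of effort produces increments; law `F` of the size of an increment. The discount rate is
normalised to `1`. Values of `u` outside `[0,1] × [0,∞)` are irrelevant. -/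

/-- Gross benefits `b(x) = u(0,x)`. -/
def benefit (u : ℝ → ℝ → ℝ) (x : ℝ) : ℝ := u 0 x

/-- Opportunity cost of effort `c(a,x) = u(0,x) - u(a,x)`. -/
def cost (u : ℝ → ℝ → ℝ) (a x : ℝ) : ℝ := u 0 x - u a x

/-- Marginal cost `c₁(a,x)`, for `a ∈ [0,1]` (one-sided at the end points). -/
def cost₁ (u : ℝ → ℝ → ℝ) (a x : ℝ) : ℝ := derivWithin (fun a' => cost u a' x) (Icc 0 1) a

/-- Second derivative `c₁₁(a,x)`, for `a ∈ [0,1]` (one-sided at the end points). -/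
def cost₁₁ (u : ℝ → ℝ → ℝ) (a x : ℝ) : ℝ := derivWithin (fun a' => cost₁ u a' x) (Icc 0 1) a

/-- Mean size `μ` of an increment. -/
def meanSize (F : Measure ℝ) : ℝ := ∫ z, z ∂F

/-- The expected value `E_F[v(x + z̃)]`. -/
def expAfter (F : Measure ℝ) (v : ℝ → ℝ) (x : ℝ) : ℝ := ∫ z, v (x + z) ∂F

/-- The standing assumptions on the primitives. -/
structure StandingAssumptions (n : ℕ) (u : ℝ → ℝ → ℝ) (lam : ℝ) (F : Measure ℝ) : Prop where
  two_le : 2 ≤ n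
  lam_pos : 0 < lam
  size_pos : F (Iic 0) = 0
  size_integrable : Integrable (fun z : ℝ => z) F
  u_contDiff : ContDiffOn ℝ 2 (fun p : ℝ × ℝ => u p.1 p.2) (Icc 0 1 ×ˢ Ici 0)
  u_mono : ∀ a ∈ Icc (0 : ℝ) 1, MonotoneOn (fun x => u a x) (Ici 0)
  u_concave : ∀ a ∈ Icc (0 : ℝ) 1, ConcaveOn ℝ (Ici 0) (fun x => u a x)
  cost_mono : ∀ x : ℝ, 0 ≤ x → MonotoneOn (fun a => cost u a x) (Icc 0 1)
  cost_convex : ∀ x : ℝ, 0 ≤ x → ConvexOn ℝ (Icc 0 1) (fun a => cost u a x)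
  cost_strictMono : ∀ x : ℝ, 0 < x → StrictMonoOn (fun a => cost u a x) (Icc 0 1)
  cost₁_mono : ∀ a ∈ Icc (0 : ℝ) 1, MonotoneOn (fun x => cost₁ u a x) (Ici 0)
  cost₁₁_mono : ∀ a ∈ Icc (0 : ℝ) 1, MonotoneOn (fun x => cost₁₁ u a x) (Ici 0)
  /-- `lim_{x → ∞} λ μ n b'(x) - c₁(a,x)` (a limit in `[-∞,∞]`) is negative for `0 < a ≤ 1`. -/
  effort_inefficient : ∀ a ∈ Ioc (0 : ℝ) 1, ∃ L : EReal, L < 0 ∧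
    Tendsto (fun x : ℝ => ((lam * meanSize F * n * derivWithin (benefit u) (Ici 0) x
      - cost₁ u a x : ℝ) : EReal)) atTop (𝓝 L)

/-! ### Histories and strategies -/

/-- An innovation: its time, its size and the agent who produced it. -/
abbrev Event (n : ℕ) : Type := ℝ × ℝ × Fin n

/-- A public history featuring `m` innovations: the initial stock and the `m` innovations. -/
abbrev Hist (n m : ℕ) : Type := ℝ × (Fin m → Event n)

/-- The stock `X(h)` after a history. -/
def Hist.stock {n m : ℕ} (h : Hist n m) : ℝ := h.1 + ∑ l, (h.2 l).2.1

/-- The time `T(h)` of the last innovation of a history (`0` if there is none). -/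
def Hist.time {n : ℕ} : {m : ℕ} → Hist n m → ℝ
  | 0, _ => 0
  | m + 1, h => (h.2 (Fin.last m)).1

/-- A (pure, public, not necessarily Markov) strategy: for every history `h`, a schedule giving
effort `effort m h t` at times `t > T(h)` up to and including the time of the next innovation. -/
structure Strategy (n : ℕ) where
  effort : ∀ m : ℕ, Hist n m → ℝ → ℝ
  effort_mem : ∀ m h t, effort m h t ∈ Icc (0 : ℝ) 1
  effort_measurable : ∀ m, Measurable (fun p : Hist n m × ℝ => effort m p.1 p.2)

/-- A Markov strategy: a Borel map from stocks to effort levels in `[0,1]`. -/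
structure MarkovStrategy where
  toFun : ℝ → ℝ
  mem_Icc : ∀ x, toFun x ∈ Icc (0 : ℝ) 1
  measurable : Measurable toFun

instance : CoeFun MarkovStrategy (fun _ => ℝ → ℝ) := ⟨MarkovStrategy.toFun⟩

lemma Hist.measurable_stock {n m : ℕ} : Measurable (Hist.stock : Hist n m → ℝ) := by
  unfold Hist.stock
  fun_prop

/-- The strategy that exerts effort `α(X(h))` after each history `h`. -/
def MarkovStrategy.toStrategy (α : MarkovStrategy) (n : ℕ) : Strategy n where
  effort _ h _ := α h.stock
  effort_mem _ _ _ := α.mem_Icc _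
  effort_measurable _ := α.measurable.comp (Hist.measurable_stock.comp measurable_fst)

/-- The profile in which all `n` agents play the Markov strategy `α`. -/
def MarkovStrategy.profile (α : MarkovStrategy) (n : ℕ) : Fin n → Strategy n :=
  fun _ => α.toStrategy n

/-! ### The play of a strategy profile

At each history, agent `i` has an independent unit-rate exponential clock `e i` and would produce
an innovation once her cumulative intensity `∫ lam * aⁱ` since the beginning of the history reaches
`e i`; thus agent `i` produces innovations at rate `lam * aⁱ_t`, independently across agents. The
next innovation is the first one to arrive, and its size is an independent draw from `F`. -/

/-- The randomness of the game: for each `m`, the clocks of the agents after the `m`-th innovation,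
and the size of the next innovation. -/
abbrev Noise (n : ℕ) : Type := ℕ → (Fin n → ℝ) × ℝ

/-- The law of the randomness: unit exponential clocks and sizes of law `F`, all independent. -/
def noiseLaw (n : ℕ) (F : Measure ℝ) : Measure (Noise n) :=
  Measure.infinitePi (fun _ : ℕ => (Measure.pi (fun _ : Fin n => expMeasure 1)).prod F)

/-- The first time `t ≥ t₀` at which `∫_{t₀}^t lam * a` reaches `e` (`⊤` if there is none). -/
def arrival (lam : ℝ) (a : ℝ → ℝ) (t₀ e : ℝ) : EReal :=
  sInf ((fun t : ℝ => (t : EReal)) '' {t : ℝ | t₀ ≤ t ∧ e ≤ ∫ s in t₀..t, lam * a s})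

/-- The time at which agent `i` would produce the next innovation, if no other agent did before. -/
def agentArrival {n m : ℕ} (lam : ℝ) (σ : Fin n → Strategy n) (h : Hist n m) (e : Fin n → ℝ)
    (i : Fin n) : EReal :=
  arrival lam ((σ i).effort m h) h.time (e i)

/-- The time of the innovation following `h` (`⊤` if there is none). -/
def nextTime {n m : ℕ} (lam : ℝ) (σ : Fin n → Strategy n) (h : Hist n m) (e : Fin n → ℝ) :
    EReal :=
  ⨅ i, agentArrival lam σ h e i

open Classical in
/-- The history reached upon the innovation following `h`, given clocks `e` and size `z`
(`none` if no innovation follows). Ties, which have probability zero, favour the lowest index. -/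
def nextHist {n m : ℕ} (lam : ℝ) (σ : Fin n → Strategy n) (h : Hist n m) (e : Fin n → ℝ) (z : ℝ) :
    Option (Hist n (m + 1)) :=
  if hi : ∃ i, agentArrival lam σ h e i = nextTime lam σ h e ∧ nextTime lam σ h e ≠ ⊤ then
    some (h.1, Fin.snoc h.2 ((nextTime lam σ h e).toReal, z, Fin.find _ hi))
  else none

/-- The history reached upon the `m`-th innovation when `σ` is played from the initial stock `x₀`
(`none` if fewer than `m` innovations are ever produced). -/
def path {n : ℕ} (lam : ℝ) (σ : Fin n → Strategy n) (x₀ : ℝ) (ω : Noise n) :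
    (m : ℕ) → Option (Hist n m)
  | 0 => some (x₀, Fin.elim0)
  | m + 1 => (path lam σ x₀ ω m).bind (fun h => nextHist lam σ h (ω m).1 (ω m).2)

/-- The stock `x̃_t`: the initial stock plus all the increments produced up to time `t`. -/
def stockAt {n : ℕ} (lam : ℝ) (σ : Fin n → Strategy n) (x₀ : ℝ) (ω : Noise n) (t : ℝ) : ℝ :=
  x₀ + ∑' m : ℕ, (path lam σ x₀ ω (m + 1)).elim 0
    (fun h => if h.time ≤ t then (h.2 (Fin.last m)).2.1 else 0)

/-! ### Payoffs, welfare and efficient effort -/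

/-- Discounted payoff of agent `i` between the `m`-th innovation and the next one. -/
def stagePayoff {n : ℕ} (u : ℝ → ℝ → ℝ) (lam : ℝ) (σ : Fin n → Strategy n) (i : Fin n) (x₀ : ℝ)
    (ω : Noise n) (m : ℕ) : ℝ :=
  (path lam σ x₀ ω m).elim 0 (fun h =>
    ∫ t in {t : ℝ | h.time < t ∧ (t : EReal) < nextTime lam σ h (ω m).1},
      Real.exp (-t) * (benefit u h.stock - cost u ((σ i).effort m h t) h.stock))

/-- Ex-ante payoff of agent `i` when the profile `σ` is played from the initial stock `x₀`. -/
def payoff {n : ℕ} (u : ℝ → ℝ → ℝ) (lam : ℝ) (F : Measure ℝ) (σ : Fin n → Strategy n) (i : Fin n)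
    (x₀ : ℝ) : ℝ :=
  ∑' m : ℕ, ∫ ω, stagePayoff u lam σ i x₀ ω m ∂(noiseLaw n F)

/-- Welfare: the average ex-ante payoff across agents. -/
def welfare {n : ℕ} (u : ℝ → ℝ → ℝ) (lam : ℝ) (F : Measure ℝ) (σ : Fin n → Strategy n)
    (x₀ : ℝ) : ℝ :=
  (∑ i, payoff u lam F σ i x₀) / n

/-- Maximal welfare `v_*(x₀)` across all (Markov and non-Markov) strategy profiles. -/
def maxWelfare (n : ℕ) (u : ℝ → ℝ → ℝ) (lam : ℝ) (F : Measure ℝ) (x₀ : ℝ) : ℝ :=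
  ⨆ σ : Fin n → Strategy n, welfare u lam F σ x₀

/-- The maximisers over `a ∈ [0,1]` of `a λ n {E_F[v_*(x + z̃)] - v_*(x)} - c(a,x)`. -/
def efficientEffortSet (n : ℕ) (u : ℝ → ℝ → ℝ) (lam : ℝ) (F : Measure ℝ) (x : ℝ) : Set ℝ :=
  {a | a ∈ Icc (0 : ℝ) 1 ∧ IsMaxOn (fun a' : ℝ =>
    a' * lam * n * (expAfter F (maxWelfare n u lam F) x - maxWelfare n u lam F x) - cost u a' x)
    (Icc 0 1) a}

/-- `α` is the efficient effort `α_*`: if played by all agents it maximises welfare, across all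
strategy profiles and for every initial stock, and it is the pointwise smallest selection from the
efficient effort levels. -/
structure IsEfficientEffort (n : ℕ) (u : ℝ → ℝ → ℝ) (lam : ℝ) (F : Measure ℝ)
    (α : MarkovStrategy) : Prop where
  maximises : ∀ x₀ : ℝ, 0 ≤ x₀ →
    IsGreatest (range fun σ : Fin n → Strategy n => welfare u lam F σ x₀)
      (welfare u lam F (α.profile n) x₀)
  smallest : ∀ x : ℝ, 0 ≤ x → IsLeast (efficientEffortSet n u lam F x) (α x)

/-- The marginal social value `λ n {E_F[b(x + z̃)] - b(x)}` of effort at stock `x` if no effort is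
exerted after an innovation occurs. -/
def socialValue (n : ℕ) (u : ℝ → ℝ → ℝ) (lam : ℝ) (F : Measure ℝ) (x : ℝ) : ℝ :=
  lam * n * (expAfter F (benefit u) x - benefit u x)

end

end InnovationGame

open InnovationGame

/-!
The planner's problem is solved by verification. Write `b = u 0` for the benefits and
`v = b + w`. The Hamilton-Jacobi-Bellman equation

`v x = max_{a ∈ [0,1]} {u a x + a lam n (E v(x + z) - v x)}`

is equivalent to a fixed-point equation for `w` that is a contraction with factor
`lam n / (1 + lam n)` on bounded continuous functions (`Regular.exists_fixedPoint`). Concavity of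
`b` and its differentiability at the origin make `b` Lipschitz, so that `E b(x + z) - b x` is
bounded and the equation for `w` is well posed although `b` may be unbounded.

At a fixed history, the time of the next innovation has survival function `exp (-∫ intensity)`.
Integration over the clocks turns the payoff up to that time plus the continuation value `v` into
a single flow; the Hamilton-Jacobi-Bellman inequality holds for the effort of each agent separately,
hence on average, and bounds this flow by the derivative of `-exp (-t - ∫ intensity)` up to a factor
(`integral_stepReward_le`, with equality in `integral_stepReward_eq` if efforts are maximisers). The
noise behind the next innovation is independent of the history (`integral_path_elim`), so the
inequality can be summed over the innovations. The remainder vanishes because a weight of linear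
growth shrinks geometrically in expectation from one innovation to the next
(`integrable_discounted_weight`). Hence `v` is the maximal welfare on `[0,∞)`, and it is attained
by the smallest maximiser, which is a measurable function of the stock
(`welfare_le_of_supersolution`, `welfare_eq_of_solution`, `exists_measurable_isLeast_isMaxOn`).

By convexity of costs, `socialValue x ≤ cost₁ u 0 x` means that no effort pays for itself at `x` if
no effort follows. Since `socialValue` is nonincreasing and `cost₁ u 0` is nondecreasing, this
inequality persists at higher stocks, where therefore `w = 0` and the smallest maximiser is `0`
(`HJBSolution.eq_benefit`). If the inequality fails at `x`, zero effort cannot be optimal there, as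
it would imply `v x = b x` while `E v(x + z) ≥ E b(x + z)`.

As effort is constant between innovations, positive effort produces the next innovation in finite
time. The sizes add up to infinity by the law of large numbers (`ae_tendsto_sum_size`), and the
innovations do not accumulate because the expected discount factors are summable
(`ae_nonExplosive`). So the stock crosses every threshold below which effort is positive, at the
time of an innovation (`exists_isLeast_crossing`).
-/

namespace InnovationGame

/-! ### Survival functions of intensities -/

lemma intervalIntegrable_of_mem_Icc {a : ℝ → ℝ} (ha : Measurable a) {C : ℝ}
    (hb : ∀ t, a t ∈ Icc (0 : ℝ) C) (s t : ℝ) : IntervalIntegrable a volume s t := by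
  refine (intervalIntegrable_const (c := C)).mono_fun ha.aestronglyMeasurable
    (Eventually.of_forall fun x => ?_)
  simp only [Real.norm_eq_abs, abs_of_nonneg (hb x).1]
  exact (hb x).2.trans (le_abs_self C)

lemma integral_mono_right_of_mem_Icc {a : ℝ → ℝ} (ha : Measurable a) {C : ℝ}
    (hb : ∀ t, a t ∈ Icc (0 : ℝ) C) {T s t : ℝ} (hst : s ≤ t) :
    ∫ r in T..s, a r ≤ ∫ r in T..t, a r := by
  have h := intervalIntegral.integral_add_adjacent_intervals
    (intervalIntegrable_of_mem_Icc ha hb T s) (intervalIntegrable_of_mem_Icc ha hb s t)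
  have := intervalIntegral.integral_nonneg (μ := volume) hst (fun r _ => (hb r).1)
  linarith

lemma lipschitzWith_integral_of_mem_Icc {a : ℝ → ℝ} (ha : Measurable a) {C : ℝ}
    (hb : ∀ t, a t ∈ Icc (0 : ℝ) C) (T : ℝ) :
    LipschitzWith C.toNNReal (fun t => ∫ r in T..t, a r) := by
  have hC : 0 ≤ C := (hb 0).1.trans (hb 0).2
  refine LipschitzWith.of_dist_le_mul fun s t => ?_
  rw [Real.dist_eq, intervalIntegral.integral_interval_sub_left
    (intervalIntegrable_of_mem_Icc ha hb T s) (intervalIntegrable_of_mem_Icc ha hb T t),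
    Real.coe_toNNReal _ hC, Real.dist_eq, ← Real.norm_eq_abs]
  refine intervalIntegral.norm_integral_le_of_norm_le_const fun x _ => ?_
  rw [Real.norm_of_nonneg (hb x).1]
  exact (hb x).2

lemma continuous_integral_of_mem_Icc {a : ℝ → ℝ} (ha : Measurable a) {C : ℝ}
    (hb : ∀ t, a t ∈ Icc (0 : ℝ) C) (T : ℝ) : Continuous (fun t => ∫ r in T..t, a r) :=
  (lipschitzWith_integral_of_mem_Icc ha hb T).continuous

lemma integrableOn_Ioi_exp_neg_mul (T : ℝ) {g : ℝ → ℝ} (hg : Measurable g) {C : ℝ}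
    (hb : ∀ t, T < t → |g t| ≤ C) : IntegrableOn (fun t => Real.exp (-t) * g t) (Ioi T) := by
  have h : IntegrableOn (fun t => Real.exp (-t)) (Ioi T) := integrableOn_exp_neg_Ioi T
  refine (h.mul_const C).mono (by fun_prop) ?_
  filter_upwards [ae_restrict_mem measurableSet_Ioi] with t ht
  rw [norm_mul, norm_mul]
  gcongr
  exact (hb t ht).trans (le_abs_self C)

/-- If `a` is the intensity of an arrival from time `T` on, then `(1 + a t) exp (-t - ∫ a)` is the
density, times `exp (-T)`, of the minimum of the arrival time and an independent unit exponential
time. As `a` is merely measurable, this is the fundamental theorem of calculus for the Lipschitz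
function `t ↦ exp (-t - ∫ a)`. -/
lemma integral_exp_neg_mul_survival {a : ℝ → ℝ} (ha : Measurable a) {C : ℝ}
    (hb : ∀ t, a t ∈ Icc (0 : ℝ) C) (T : ℝ) :
    ∫ t in Ioi T, Real.exp (-t) * (Real.exp (-∫ r in T..t, a r) * (1 + a t)) = Real.exp (-T) := by
  set A : ℝ → ℝ := fun t => ∫ r in T..t, a r with hA
  have hAc : Continuous A := continuous_integral_of_mem_Icc ha hb T
  have hA0 : ∀ t, T ≤ t → 0 ≤ A t := fun t ht =>
    intervalIntegral.integral_nonneg ht (fun r _ => (hb r).1)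
  have hint : IntegrableOn (fun t => Real.exp (-t) * (Real.exp (-A t) * (1 + a t))) (Ioi T) := by
    refine integrableOn_Ioi_exp_neg_mul T (C := 1 + C) (by fun_prop) fun t ht => ?_
    rw [abs_of_nonneg (mul_nonneg (Real.exp_nonneg _) (by linarith [(hb t).1]))]
    have h1 : Real.exp (-A t) ≤ 1 := Real.exp_le_one_iff.2 (by linarith [hA0 t ht.le])
    nlinarith [(hb t).1, (hb t).2, Real.exp_nonneg (-A t)]
  have hfin : ∀ R, T ≤ R →
      ∫ t in T..R, Real.exp (-t) * (Real.exp (-A t) * (1 + a t))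
        = Real.exp (-T) - Real.exp (-R - A R) := by
    intro R hR
    set f : ℝ → ℝ := fun t => -Real.exp (-(t + A t)) with hf
    have hlip : LipschitzWith (1 + C.toNNReal) (fun t => t + A t) :=
      LipschitzWith.id.add (lipschitzWith_integral_of_mem_Icc ha hb T)
    have hexp : LipschitzOnWith (Real.toNNReal (Real.exp (-T))) (fun y : ℝ => -Real.exp (-y))
        (Ici T) := by
      refine Convex.lipschitzOnWith_of_nnnorm_hasDerivWithin_le (convex_Ici T)
        (f' := fun y => Real.exp (-y)) (fun y _ => ?_) (fun y hy => ?_)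
      · have h1 : HasDerivAt (fun y : ℝ => -Real.exp (-y)) (-(Real.exp (-y) * -1)) y :=
          ((hasDerivAt_neg y).exp).neg
        rw [mul_neg_one, neg_neg] at h1
        exact h1.hasDerivWithinAt
      · rw [← NNReal.coe_le_coe, coe_nnnorm, Real.norm_of_nonneg (Real.exp_nonneg _),
          Real.coe_toNNReal _ (Real.exp_nonneg _)]
        exact Real.exp_le_exp.2 (neg_le_neg hy)
    have hcomp : LipschitzOnWith (Real.toNNReal (Real.exp (-T)) * (1 + C.toNNReal)) f
        (uIcc T R) := by
      refine hexp.comp hlip.lipschitzOnWith fun t ht => ?_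
      rw [uIcc_of_le hR] at ht
      exact ht.1.trans (le_add_of_nonneg_right (hA0 t ht.1))
    have hftc := hcomp.absolutelyContinuousOnInterval.integral_deriv_eq_sub
    have hloc : LocallyIntegrable a volume := by
      intro x
      refine ⟨Icc (x - 1) (x + 1), Icc_mem_nhds (by linarith) (by linarith), ?_⟩
      exact (intervalIntegrable_iff_integrableOn_Icc_of_le (by linarith)).1
        (intervalIntegrable_of_mem_Icc ha hb (x - 1) (x + 1))
    have hderiv := LocallyIntegrable.ae_hasDerivAt_integral hloc
    have hcongr : ∫ t in T..R, deriv f t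
        = ∫ t in T..R, Real.exp (-t) * (Real.exp (-A t) * (1 + a t)) := by
      refine intervalIntegral.integral_congr_ae ?_
      filter_upwards [hderiv] with t ht _
      have h1 : HasDerivAt A (a t) t := ht T
      have h2 : HasDerivAt f (-(Real.exp (-(t + A t)) * -(1 + a t))) t :=
        (((hasDerivAt_id t).add h1).neg.exp).neg
      rw [h2.deriv, neg_add, Real.exp_add]
      ring
    rw [← hcongr, hftc]
    simp only [hf, hA, intervalIntegral.integral_same]
    rw [neg_add, ← sub_eq_add_neg]
    simp
    ring
  have hlim1 := intervalIntegral_tendsto_integral_Ioi T hint tendsto_id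
  have hlim2 : Tendsto (fun R => Real.exp (-T) - Real.exp (-R - A R)) atTop
      (𝓝 (Real.exp (-T) - 0)) := by
    refine tendsto_const_nhds.sub ?_
    refine squeeze_zero' (Eventually.of_forall fun _ => Real.exp_nonneg _) ?_
      (Real.tendsto_exp_neg_atTop_nhds_zero)
    filter_upwards [eventually_ge_atTop T] with R hR
    exact Real.exp_le_exp.2 (by linarith [hA0 R hR])
  rw [sub_zero] at hlim2
  refine tendsto_nhds_unique hlim1 (hlim2.congr' ?_)
  filter_upwards [eventually_ge_atTop T] with R hR
  exact (hfin R hR).symm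

/-! ### Arrival times -/

section Arrival

variable {lam : ℝ} {a : ℝ → ℝ} {T e : ℝ}

lemma mul_mem_Icc_of_mem_Icc (hl : 0 < lam) (hb : ∀ t, a t ∈ Icc (0 : ℝ) 1) (t : ℝ) :
    lam * a t ∈ Icc (0 : ℝ) lam :=
  ⟨mul_nonneg hl.le (hb t).1, mul_le_of_le_one_right hl.le (hb t).2⟩

lemma le_arrival (lam : ℝ) (a : ℝ → ℝ) (T e : ℝ) : (T : EReal) ≤ arrival lam a T e := by
  refine le_sInf ?_
  rintro _ ⟨t, ht, rfl⟩
  exact EReal.coe_le_coe_iff.2 ht.1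

/-- The infimum in the definition of an arrival time is attained, as the cumulative intensity is
continuous. -/
lemma arrival_le_iff (hl : 0 < lam) (ha : Measurable a) (hb : ∀ t, a t ∈ Icc (0 : ℝ) 1) (s : ℝ) :
    arrival lam a T e ≤ s ↔ T ≤ s ∧ e ≤ ∫ r in T..s, lam * a r := by
  have hm : Measurable fun t => lam * a t := ha.const_mul lam
  have hb' := mul_mem_Icc_of_mem_Icc hl hb
  set S := {t : ℝ | T ≤ t ∧ e ≤ ∫ s in T..t, lam * a s} with hS
  constructor
  · intro h
    have hcl : IsClosed S :=
      (isClosed_le continuous_const continuous_id).inter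
        (isClosed_le continuous_const (continuous_integral_of_mem_Icc hm hb' T))
    have hbdd : BddBelow S := ⟨T, fun t ht => ht.1⟩
    have hne : S.Nonempty := by
      by_contra hne
      rw [not_nonempty_iff_eq_empty] at hne
      have : arrival lam a T e = ⊤ := by
        simp only [arrival]
        rw [← hS, hne, image_empty, sInf_empty]
      rw [this] at h
      exact absurd h (by simp)
    have hmin : sInf S ∈ S := hcl.csInf_mem hne hbdd
    have hle : ((sInf S : ℝ) : EReal) ≤ s := by
      refine le_trans (le_sInf ?_) h
      rintro _ ⟨t, ht, rfl⟩
      exact EReal.coe_le_coe_iff.2 (csInf_le hbdd ht)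
    have hle' := EReal.coe_le_coe_iff.1 hle
    exact ⟨hmin.1.trans hle', hmin.2.trans (integral_mono_right_of_mem_Icc hm hb' hle')⟩
  · intro h
    exact sInf_le ⟨s, h, rfl⟩

lemma lt_arrival_iff (hl : 0 < lam) (ha : Measurable a) (hb : ∀ t, a t ∈ Icc (0 : ℝ) 1) {s : ℝ}
    (hs : T ≤ s) : (s : EReal) < arrival lam a T e ↔ ∫ r in T..s, lam * a r < e := by
  rw [← not_le, arrival_le_iff hl ha hb, not_and, not_le]
  exact ⟨fun h => h hs, fun h _ => h⟩

end Arrival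

lemma exists_agentArrival_eq_nextTime {n m : ℕ} [NeZero n] (lam : ℝ) (σ : Fin n → Strategy n)
    (h : Hist n m) (e : Fin n → ℝ) : ∃ i, agentArrival lam σ h e i = nextTime lam σ h e :=
  exists_eq_ciInf_of_finite

lemma le_nextTime {n m : ℕ} (lam : ℝ) (σ : Fin n → Strategy n)
    (h : Hist n m) (e : Fin n → ℝ) : (h.time : EReal) ≤ nextTime lam σ h e :=
  le_iInf fun _ => le_arrival _ _ _ _

lemma Strategy.measurable_effort {n m : ℕ} (σ : Strategy n) (h : Hist n m) :
    Measurable (σ.effort m h) :=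
  (σ.effort_measurable m).comp measurable_prodMk_left

lemma lt_nextTime_iff {n m : ℕ} [NeZero n] {lam : ℝ} (hl : 0 < lam) (σ : Fin n → Strategy n)
    (h : Hist n m) (e : Fin n → ℝ) {s : ℝ} (hs : h.time ≤ s) :
    (s : EReal) < nextTime lam σ h e ↔
      ∀ i, ∫ r in h.time..s, lam * (σ i).effort m h r < e i := by
  have key : (s : EReal) < nextTime lam σ h e ↔ ∀ i, (s : EReal) < agentArrival lam σ h e i := by
    constructor
    · exact fun hlt i => hlt.trans_le (iInf_le _ i)
    · intro hall
      obtain ⟨i, hi⟩ := exists_agentArrival_eq_nextTime lam σ h e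
      rw [← hi]
      exact hall i
  rw [key]
  exact forall_congr' fun i =>
    lt_arrival_iff hl ((σ i).measurable_effort h) ((σ i).effort_mem m h) hs

/-! ### Measurability of arrival times in the history -/

lemma Hist.measurable_time {n : ℕ} : ∀ {m : ℕ}, Measurable (Hist.time : Hist n m → ℝ)
  | 0 => measurable_const
  | m + 1 => by
    show Measurable fun h : Hist n (m + 1) => (h.2 (Fin.last m)).1
    fun_prop

lemma measurable_intervalIntegral_left {α : Type*} [MeasurableSpace α] {T : α → ℝ}
    (hT : Measurable T) {f : α → ℝ → ℝ} (hf : Measurable (Function.uncurry f)) (s : ℝ) :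
    Measurable fun x => ∫ r in T x..s, f x r := by
  have h1 : MeasurableSet {p : α × ℝ | p.2 ∈ Ioc (T p.1) s} :=
    (measurableSet_lt (hT.comp measurable_fst) measurable_snd).inter
      (measurableSet_le measurable_snd measurable_const)
  have h2 : MeasurableSet {p : α × ℝ | p.2 ∈ Ioc s (T p.1)} :=
    (measurableSet_lt measurable_const measurable_snd).inter
      (measurableSet_le measurable_snd (hT.comp measurable_fst))
  have m1 := ((hf.indicator h1).stronglyMeasurable.integral_prod_right' (ν := volume)).measurable
  have m2 := ((hf.indicator h2).stronglyMeasurable.integral_prod_right' (ν := volume)).measurable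
  have : (fun x => ∫ r in T x..s, f x r)
      = fun x => (∫ r, {p : α × ℝ | p.2 ∈ Ioc (T p.1) s}.indicator (Function.uncurry f) (x, r))
        - ∫ r, {p : α × ℝ | p.2 ∈ Ioc s (T p.1)}.indicator (Function.uncurry f) (x, r) := by
    funext x
    rw [intervalIntegral, ← integral_indicator measurableSet_Ioc,
      ← integral_indicator measurableSet_Ioc]
    rfl
  rw [this]
  exact m1.sub m2

/-- An arrival before `c` is an arrival by some rational time before `c`. -/
lemma measurable_arrival {n m : ℕ} {lam : ℝ} (hl : 0 < lam) (σ : Strategy n) :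
    Measurable fun p : Hist n m × ℝ => arrival lam (σ.effort m p.1) p.1.time p.2 := by
  refine measurable_of_Iio fun c => ?_
  have : (fun p : Hist n m × ℝ => arrival lam (σ.effort m p.1) p.1.time p.2) ⁻¹' Iio c
      = ⋃ q : ℚ, ⋃ (_ : ((q : ℝ) : EReal) < c),
        {p | p.1.time ≤ (q : ℝ) ∧ p.2 ≤ ∫ r in p.1.time..(q : ℝ), lam * σ.effort m p.1 r} := by
    ext p
    simp only [mem_preimage, mem_Iio, mem_iUnion, mem_ofPred_eq, exists_prop]
    simp_rw [← arrival_le_iff hl (σ.measurable_effort p.1) (σ.effort_mem m p.1)]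
    constructor
    · intro h
      obtain ⟨q, hq1, hq2⟩ := EReal.lt_iff_exists_rat_btwn.1 h
      exact ⟨q, hq2, hq1.le⟩
    · rintro ⟨q, hq1, hq2⟩
      exact hq2.trans_lt hq1
  rw [this]
  refine MeasurableSet.iUnion fun q => MeasurableSet.iUnion fun _ => ?_
  refine (measurableSet_le (Hist.measurable_time.comp measurable_fst) measurable_const).inter
    (measurableSet_le measurable_snd ?_)
  refine (measurable_intervalIntegral_left Hist.measurable_time
    (f := fun h r => lam * σ.effort m h r) ?_ (q : ℝ)).comp measurable_fst
  exact (σ.effort_measurable m).const_mul lam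

lemma measurable_agentArrival {n m : ℕ} {lam : ℝ} (hl : 0 < lam) (σ : Fin n → Strategy n)
    (i : Fin n) :
    Measurable fun p : Hist n m × (Fin n → ℝ) => agentArrival lam σ p.1 p.2 i :=
  (measurable_arrival hl (σ i)).comp
    (measurable_fst.prodMk ((measurable_pi_apply i).comp measurable_snd))

lemma measurable_nextTime {n m : ℕ} {lam : ℝ} (hl : 0 < lam) (σ : Fin n → Strategy n) :
    Measurable fun p : Hist n m × (Fin n → ℝ) => nextTime lam σ p.1 p.2 :=
  Measurable.iInf fun i => measurable_agentArrival hl σ i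

/-! ### Discounting up to a random time -/

/-- The discount factor `e^{-τ}` of an event at time `τ ∈ (-∞, ∞]`, with `e^{-∞} = 0`.
The value at `-∞` plays no role. -/
noncomputable def disc (τ : EReal) : ℝ := if τ = ⊤ then 0 else Real.exp (-τ.toReal)

lemma disc_nonneg (τ : EReal) : 0 ≤ disc τ := by
  unfold disc
  split_ifs
  exacts [le_rfl, (Real.exp_pos _).le]

lemma measurable_disc : Measurable disc := by
  unfold disc
  exact Measurable.ite (measurableSet_singleton _) measurable_const (by fun_prop)

lemma disc_le {T : ℝ} {τ : EReal} (h : (T : EReal) ≤ τ) : disc τ ≤ Real.exp (-T) := by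
  unfold disc
  split_ifs with hτ
  · exact (Real.exp_pos _).le
  · refine Real.exp_le_exp.2 (neg_le_neg ?_)
    simpa using EReal.toReal_le_toReal h (EReal.coe_ne_bot T) hτ

lemma measurableSet_Ioo_coe (T : ℝ) (τ : EReal) :
    MeasurableSet {t : ℝ | T < t ∧ (t : EReal) < τ} :=
  (measurableSet_lt measurable_const measurable_id).inter
    (measurableSet_lt measurable_coe_real_ereal measurable_const)

lemma setIntegral_Ioo_coe (T : ℝ) (τ : EReal) (g : ℝ → ℝ) :
    ∫ t in {t : ℝ | T < t ∧ (t : EReal) < τ}, g t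
      = ∫ t in Ioi T, {t : ℝ | (t : EReal) < τ}.indicator g t := by
  rw [setIntegral_indicator (measurableSet_lt measurable_coe_real_ereal measurable_const)]
  rfl

lemma integral_exp_neg_eq_sub_disc {T : ℝ} {τ : EReal} (h : (T : EReal) ≤ τ) :
    ∫ t in {t : ℝ | T < t ∧ (t : EReal) < τ}, Real.exp (-t) = Real.exp (-T) - disc τ := by
  induction τ using EReal.rec with
  | bot => simp at h
  | top =>
    have : {t : ℝ | T < t ∧ (t : EReal) < ⊤} = Ioi T := by
      ext t
      simp [EReal.coe_lt_top]
    rw [this, integral_exp_neg_Ioi]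
    simp [disc]
  | coe s =>
    have hs : T ≤ s := EReal.coe_le_coe_iff.1 h
    have : {t : ℝ | T < t ∧ (t : EReal) < s} = Ioo T s := by
      ext t
      simp
    rw [this, ← integral_Ioc_eq_integral_Ioo, ← intervalIntegral.integral_of_le hs]
    simp [disc]

/-- Expected flow up to a random time `τ` with survival function `S`. -/
lemma integral_integral_lt_eq {Ω : Type*} [MeasurableSpace Ω] {P : Measure Ω}
    [IsProbabilityMeasure P] {τ : Ω → EReal} (hτ : Measurable τ) {T : ℝ} {S : ℝ → ℝ}
    (hS : ∀ t, T < t → P.real {ω | (t : EReal) < τ ω} = S t) {g : ℝ → ℝ}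
    (hg : IntegrableOn g (Ioi T)) :
    ∫ ω, (∫ t in {t : ℝ | T < t ∧ (t : EReal) < τ ω}, g t) ∂P = ∫ t in Ioi T, S t * g t := by
  have hms : MeasurableSet {p : Ω × ℝ | (p.2 : EReal) < τ p.1} :=
    measurableSet_lt (measurable_coe_real_ereal.comp measurable_snd) (hτ.comp measurable_fst)
  have hint : Integrable ({p : Ω × ℝ | (p.2 : EReal) < τ p.1}.indicator fun p => g p.2)
      (P.prod (volume.restrict (Ioi T))) :=
    (Integrable.comp_snd hg P).indicator hms
  simp_rw [setIntegral_Ioo_coe]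
  have h1 := integral_integral_swap (f := fun ω t => {t : ℝ | (t : EReal) < τ ω}.indicator g t)
    (μ := P) (ν := volume.restrict (Ioi T)) hint
  rw [h1]
  refine setIntegral_congr_fun measurableSet_Ioi fun t ht => ?_
  have h2 : ∀ ω, {t : ℝ | (t : EReal) < τ ω}.indicator g t
      = {ω | (t : EReal) < τ ω}.indicator (fun _ => g t) ω := fun ω => rfl
  simp only [h2]
  rw [integral_indicator_const _ (measurableSet_lt measurable_const hτ), hS t ht, smul_eq_mul]

instance : IsProbabilityMeasure (expMeasure 1) := isProbabilityMeasure_expMeasure one_pos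

lemma expMeasure_real_Ioi {x : ℝ} (hx : 0 ≤ x) : (expMeasure 1).real (Ioi x) = Real.exp (-x) := by
  have h := cdf_expMeasure_eq one_pos x
  rw [cdf_eq_real, if_pos hx] at h
  rw [← compl_Iic, probReal_compl_eq_one_sub measurableSet_Iic, h]
  simp

/-- The law of the clocks and the size that determine the next innovation. -/
noncomputable abbrev stepLaw (n : ℕ) (F : Measure ℝ) : Measure ((Fin n → ℝ) × ℝ) :=
  (Measure.pi (fun _ : Fin n => expMeasure 1)).prod F

section Step

variable {n m : ℕ} {lam : ℝ}

/-- Total intensity at which innovations are produced after the history `h`. -/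
noncomputable def intensity (lam : ℝ) (σ : Fin n → Strategy n) (h : Hist n m) (t : ℝ) : ℝ :=
  ∑ i, lam * (σ i).effort m h t

lemma measurable_intensity (lam : ℝ) (σ : Fin n → Strategy n) (h : Hist n m) :
    Measurable (intensity lam σ h) :=
  Finset.measurable_sum _ fun i _ => ((σ i).measurable_effort h).const_mul lam

lemma intensity_mem_Icc (hl : 0 < lam) (σ : Fin n → Strategy n) (h : Hist n m) (t : ℝ) :
    intensity lam σ h t ∈ Icc 0 (lam * n) := by
  refine ⟨Finset.sum_nonneg fun i _ => mul_nonneg hl.le ((σ i).effort_mem m h t).1, ?_⟩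
  calc intensity lam σ h t ≤ ∑ _i : Fin n, lam :=
        Finset.sum_le_sum fun i _ => mul_le_of_le_one_right hl.le ((σ i).effort_mem m h t).2
    _ = lam * n := by simp [mul_comm]

lemma measurable_nextTime_right (hl : 0 < lam) (σ : Fin n → Strategy n) (h : Hist n m) :
    Measurable fun e => nextTime lam σ h e :=
  Measurable.iInf fun i => (measurable_agentArrival hl σ i).comp measurable_prodMk_left

/-- The next innovation arrives at the rate given by the total intensity. -/
lemma clocks_real_lt_nextTime [NeZero n] (hl : 0 < lam) (σ : Fin n → Strategy n) (h : Hist n m)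
    {t : ℝ} (ht : h.time ≤ t) :
    (Measure.pi (fun _ : Fin n => expMeasure 1)).real {e | (t : EReal) < nextTime lam σ h e}
      = Real.exp (-∫ r in h.time..t, intensity lam σ h r) := by
  have hset : {e | (t : EReal) < nextTime lam σ h e}
      = univ.pi fun i => Ioi (∫ r in h.time..t, lam * (σ i).effort m h r) := by
    ext e
    simp [lt_nextTime_iff hl σ h e ht]
  have hint : ∀ i ∈ (Finset.univ : Finset (Fin n)), IntervalIntegrable
      (fun r => lam * (σ i).effort m h r) volume h.time t := fun i _ =>
    intervalIntegrable_of_mem_Icc (((σ i).measurable_effort h).const_mul lam)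
      (mul_mem_Icc_of_mem_Icc hl ((σ i).effort_mem m h)) _ _
  have hsum : ∫ r in h.time..t, intensity lam σ h r
      = ∑ i, ∫ r in h.time..t, lam * (σ i).effort m h r :=
    intervalIntegral.integral_finsetSum hint
  rw [hset, hsum, ← Finset.sum_neg_distrib, Real.exp_sum, measureReal_def, Measure.pi_pi,
    ENNReal.toReal_prod]
  refine Finset.prod_congr rfl fun i _ => ?_
  rw [← measureReal_def]
  exact expMeasure_real_Ioi (intervalIntegral.integral_nonneg ht
    fun r _ => mul_nonneg hl.le ((σ i).effort_mem m h r).1)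

/-- The discounted payoff of agent `i` between the history `h` and the next innovation. -/
noncomputable def stageValue (u : ℝ → ℝ → ℝ) (lam : ℝ) (σ : Fin n → Strategy n) (i : Fin n)
    (h : Hist n m) (e : Fin n → ℝ) : ℝ :=
  ∫ t in {t : ℝ | h.time < t ∧ (t : EReal) < nextTime lam σ h e},
    Real.exp (-t) * u ((σ i).effort m h t) h.stock

lemma stagePayoff_eq_elim (u : ℝ → ℝ → ℝ) (lam : ℝ) (σ : Fin n → Strategy n) (i : Fin n)
    (x₀ : ℝ) (ω : Noise n) (m : ℕ) :
    stagePayoff u lam σ i x₀ ω m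
      = (path lam σ x₀ ω m).elim 0 fun h => stageValue u lam σ i h (ω m).1 := by
  simp only [stagePayoff, stageValue, benefit, cost, sub_sub_cancel]

/-- `u` is continuous and grows at most linearly in the stock, with constant `C`. -/
structure FlowBound (u : ℝ → ℝ → ℝ) (C : ℝ) : Prop where
  cont : Continuous (Function.uncurry u)
  bound : ∀ a ∈ Icc (0 : ℝ) 1, ∀ x, |u a x| ≤ C * (1 + |x|)

lemma FlowBound.measurable {u : ℝ → ℝ → ℝ} {C : ℝ} (hu : FlowBound u C) :
    Measurable (Function.uncurry u) := hu.cont.measurable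

lemma FlowBound.measurable_flow {u : ℝ → ℝ → ℝ} {C : ℝ} (hu : FlowBound u C) (σ : Strategy n)
    (h : Hist n m) : Measurable fun t => u (σ.effort m h t) h.stock :=
  hu.measurable.comp ((σ.measurable_effort h).prodMk measurable_const)

lemma measurable_stageValue {u : ℝ → ℝ → ℝ} {C : ℝ} (hu : FlowBound u C) (hl : 0 < lam)
    (σ : Fin n → Strategy n) (i : Fin n) :
    Measurable fun p : Hist n m × (Fin n → ℝ) => stageValue u lam σ i p.1 p.2 := by
  have hs : MeasurableSet {q : (Hist n m × (Fin n → ℝ)) × ℝ |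
      q.1.1.time < q.2 ∧ (q.2 : EReal) < nextTime lam σ q.1.1 q.1.2} :=
    (measurableSet_lt (Hist.measurable_time.comp (measurable_fst.comp measurable_fst))
      measurable_snd).inter
    (measurableSet_lt (measurable_coe_real_ereal.comp measurable_snd)
      ((measurable_nextTime hl σ).comp measurable_fst))
  have he : Measurable fun q : (Hist n m × (Fin n → ℝ)) × ℝ => (σ i).effort m q.1.1 q.2 :=
    ((σ i).effort_measurable m).comp
      ((measurable_fst.comp measurable_fst).prodMk measurable_snd)
  have hX : Measurable fun q : (Hist n m × (Fin n → ℝ)) × ℝ => q.1.1.stock :=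
    Hist.measurable_stock.comp (measurable_fst.comp measurable_fst)
  have hf : Measurable fun q : (Hist n m × (Fin n → ℝ)) × ℝ =>
      Real.exp (-q.2) * u ((σ i).effort m q.1.1 q.2) q.1.1.stock :=
    (measurable_snd.neg.exp).mul (hu.measurable.comp (he.prodMk hX))
  have := ((hf.indicator hs).stronglyMeasurable.integral_prod_right' (ν := volume)).measurable
  have heq : (fun p : Hist n m × (Fin n → ℝ) => stageValue u lam σ i p.1 p.2)
      = fun p => ∫ t, {q : (Hist n m × (Fin n → ℝ)) × ℝ |
          q.1.1.time < q.2 ∧ (q.2 : EReal) < nextTime lam σ q.1.1 q.1.2}.indicator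
        (fun q => Real.exp (-q.2) * u ((σ i).effort m q.1.1 q.2) q.1.1.stock) (p, t) := by
    funext p
    rw [stageValue, ← integral_indicator (measurableSet_Ioo_coe _ _)]
    rfl
  rw [heq]
  exact this

lemma abs_stageValue_le {u : ℝ → ℝ → ℝ} {C : ℝ} (hu : FlowBound u C) (σ : Fin n → Strategy n)
    (i : Fin n) (h : Hist n m) (e : Fin n → ℝ) :
    |stageValue u lam σ i h e| ≤ Real.exp (-h.time) * (C * (1 + |h.stock|)) := by
  set K := C * (1 + |h.stock|)
  have hb : ∀ t, |u ((σ i).effort m h t) h.stock| ≤ K := fun t =>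
    hu.bound _ ((σ i).effort_mem m h t) _
  have hsub : {t : ℝ | h.time < t ∧ (t : EReal) < nextTime lam σ h e} ⊆ Ioi h.time :=
    fun t ht => ht.1
  have hint : IntegrableOn (fun t => Real.exp (-t) * K) (Ioi h.time) :=
    (integrableOn_exp_neg_Ioi h.time).mul_const K
  have hK : 0 ≤ K := (abs_nonneg _).trans (hb 0)
  rw [← Real.norm_eq_abs]
  calc ‖stageValue u lam σ i h e‖
      ≤ ∫ t in {t : ℝ | h.time < t ∧ (t : EReal) < nextTime lam σ h e}, Real.exp (-t) * K := by
        refine norm_integral_le_of_norm_le (hint.mono_set hsub) (Eventually.of_forall fun t => ?_)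
        rw [norm_mul, Real.norm_of_nonneg (Real.exp_nonneg _), Real.norm_eq_abs]
        exact mul_le_mul_of_nonneg_left (hb t) (Real.exp_nonneg _)
    _ ≤ ∫ t in Ioi h.time, Real.exp (-t) * K := by
        refine setIntegral_mono_set hint (Eventually.of_forall fun t => ?_)
          (Eventually.of_forall hsub)
        exact mul_nonneg (Real.exp_nonneg _) hK
    _ = Real.exp (-h.time) * K := by
        rw [integral_mul_const, integral_exp_neg_Ioi]

lemma integrable_disc_nextTime (hl : 0 < lam) (σ : Fin n → Strategy n) (h : Hist n m) :
    Integrable (fun e => disc (nextTime lam σ h e))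
      (Measure.pi (fun _ : Fin n => expMeasure 1)) := by
  refine (integrable_const (Real.exp (-h.time))).mono'
    (measurable_disc.comp (measurable_nextTime_right hl σ h)).aestronglyMeasurable
    (Eventually.of_forall fun e => ?_)
  rw [Real.norm_of_nonneg (disc_nonneg _)]
  exact disc_le (le_nextTime lam σ h e)

lemma integral_disc_nextTime [NeZero n] (hl : 0 < lam) (σ : Fin n → Strategy n) (h : Hist n m) :
    ∫ e, disc (nextTime lam σ h e) ∂(Measure.pi (fun _ : Fin n => expMeasure 1))
      = Real.exp (-h.time) - ∫ t in Ioi h.time,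
          Real.exp (-∫ r in h.time..t, intensity lam σ h r) * Real.exp (-t) := by
  have h1 := integral_integral_lt_eq (P := Measure.pi (fun _ : Fin n => expMeasure 1))
    (measurable_nextTime_right hl σ h) (T := h.time)
    (fun t ht => clocks_real_lt_nextTime hl σ h (le_of_lt ht)) (integrableOn_exp_neg_Ioi h.time)
  have h2 : ∀ e, ∫ t in {t : ℝ | h.time < t ∧ (t : EReal) < nextTime lam σ h e}, Real.exp (-t)
      = Real.exp (-h.time) - disc (nextTime lam σ h e) := fun e =>
    integral_exp_neg_eq_sub_disc (le_nextTime lam σ h e)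
  simp_rw [h2] at h1
  rw [integral_sub (integrable_const _) (integrable_disc_nextTime hl σ h)] at h1
  simp at h1
  rw [← h1]
  ring

end Step

/-! ### Expected continuation at a fixed history -/

section Continuation

variable {n m : ℕ} {lam : ℝ} {F : Measure ℝ} [IsProbabilityMeasure F]

/-- Average payoff of the agents between the history `h` and the next innovation, plus the
discounted value `v` of the stock after that innovation. -/
noncomputable def stepReward (u : ℝ → ℝ → ℝ) (v : ℝ → ℝ) (lam : ℝ) (σ : Fin n → Strategy n)
    (h : Hist n m) (y : (Fin n → ℝ) × ℝ) : ℝ :=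
  (∑ i, stageValue u lam σ i h y.1) / n + disc (nextTime lam σ h y.1) * v (h.stock + y.2)

/-- `v` is measurable and grows at most linearly, with constant `C`. -/
structure ValueBound (v : ℝ → ℝ) (C : ℝ) : Prop where
  meas : Measurable v
  bound : ∀ x, |v x| ≤ C * (1 + |x|)

lemma ValueBound.integrable_shift {v : ℝ → ℝ} {C : ℝ} (hv : ValueBound v C)
    (hF : Integrable (fun z : ℝ => z) F) (x : ℝ) : Integrable (fun z => v (x + z)) F := by
  have hC : 0 ≤ C := by simpa using (abs_nonneg _).trans (hv.bound 0)
  have hg : Integrable (fun z : ℝ => C * (1 + (|x| + |z|))) F :=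
    ((integrable_const _).add ((integrable_const _).add hF.abs)).const_mul C
  refine hg.mono' (hv.meas.comp (measurable_const_add x)).aestronglyMeasurable
    (Eventually.of_forall fun z => ?_)
  refine (hv.bound _).trans (mul_le_mul_of_nonneg_left ?_ hC)
  gcongr
  exact abs_add_le x z

lemma measurable_stageValue_right {u : ℝ → ℝ → ℝ} {C : ℝ} (hu : FlowBound u C) (hl : 0 < lam)
    (σ : Fin n → Strategy n) (i : Fin n) (h : Hist n m) :
    Measurable fun e => stageValue u lam σ i h e := by
  have h1 := measurable_stageValue (m := m) hu hl σ i
  have h2 : Measurable fun e : Fin n → ℝ => (h, e) := measurable_prodMk_left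
  have h3 := h1.comp h2
  exact h3

lemma integrable_stageValue {u : ℝ → ℝ → ℝ} {C : ℝ} (hu : FlowBound u C) (hl : 0 < lam)
    (σ : Fin n → Strategy n) (i : Fin n) (h : Hist n m) :
    Integrable (fun e => stageValue u lam σ i h e) (Measure.pi (fun _ : Fin n => expMeasure 1)) :=
  (integrable_const (Real.exp (-h.time) * (C * (1 + |h.stock|)))).mono'
    (measurable_stageValue_right hu hl σ i h).aestronglyMeasurable
    (Eventually.of_forall fun e => abs_stageValue_le hu σ i h e)

lemma integrable_disc_mul {v : ℝ → ℝ} {C : ℝ} (hv : ValueBound v C)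
    (hF : Integrable (fun z : ℝ => z) F) (hl : 0 < lam) (σ : Fin n → Strategy n) (h : Hist n m) :
    Integrable (fun y : (Fin n → ℝ) × ℝ => disc (nextTime lam σ h y.1) * v (h.stock + y.2))
      (stepLaw n F) :=
  (integrable_disc_nextTime hl σ h).mul_prod (hv.integrable_shift hF h.stock)

lemma integral_disc_mul (v : ℝ → ℝ) (σ : Fin n → Strategy n) (h : Hist n m) :
    ∫ y : (Fin n → ℝ) × ℝ, disc (nextTime lam σ h y.1) * v (h.stock + y.2) ∂(stepLaw n F)
      = (∫ e, disc (nextTime lam σ h e) ∂(Measure.pi (fun _ : Fin n => expMeasure 1)))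
        * expAfter F v h.stock :=
  integral_prod_mul (fun e => disc (nextTime lam σ h e)) (fun z => v (h.stock + z))

lemma integrable_survival_mul (hl : 0 < lam) (σ : Fin n → Strategy n) (h : Hist n m) {g : ℝ → ℝ}
    (hg : Measurable g) {K : ℝ} (hK : ∀ t, |g t| ≤ K) :
    IntegrableOn (fun t => Real.exp (-t) *
      (Real.exp (-∫ r in h.time..t, intensity lam σ h r) * g t)) (Ioi h.time) := by
  have hc : Measurable fun t => ∫ r in h.time..t, intensity lam σ h r :=
    (continuous_integral_of_mem_Icc (measurable_intensity lam σ h) (intensity_mem_Icc hl σ h)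
      h.time).measurable
  refine integrableOn_Ioi_exp_neg_mul h.time (C := K) (hc.neg.exp.mul hg) fun t ht => ?_
  have h0 : 0 ≤ ∫ r in h.time..t, intensity lam σ h r :=
    intervalIntegral.integral_nonneg ht.le fun r _ => (intensity_mem_Icc hl σ h r).1
  rw [abs_mul, abs_of_nonneg (Real.exp_nonneg _)]
  have h1 : Real.exp (-∫ r in h.time..t, intensity lam σ h r) ≤ 1 :=
    Real.exp_le_one_iff.2 (by linarith)
  calc _ ≤ 1 * |g t| := mul_le_mul_of_nonneg_right h1 (abs_nonneg _)
    _ ≤ K := by rw [one_mul]; exact hK t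

lemma integral_survival_mul_one_add (hl : 0 < lam) (σ : Fin n → Strategy n) (h : Hist n m)
    (K : ℝ) :
    ∫ t in Ioi h.time, Real.exp (-t) * (Real.exp (-∫ r in h.time..t, intensity lam σ h r)
      * ((1 + intensity lam σ h t) * K)) = Real.exp (-h.time) * K := by
  rw [← integral_exp_neg_mul_survival (measurable_intensity lam σ h) (intensity_mem_Icc hl σ h)
    h.time, ← integral_mul_const]
  congr 1
  funext t
  ring

variable [NeZero n]

lemma integral_stageValue {u : ℝ → ℝ → ℝ} {C : ℝ} (hu : FlowBound u C) (hl : 0 < lam)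
    (σ : Fin n → Strategy n) (i : Fin n) (h : Hist n m) :
    ∫ e, stageValue u lam σ i h e ∂(Measure.pi (fun _ : Fin n => expMeasure 1))
      = ∫ t in Ioi h.time, Real.exp (-t) * (Real.exp (-∫ r in h.time..t, intensity lam σ h r)
          * u ((σ i).effort m h t) h.stock) := by
  have hg : IntegrableOn (fun t => Real.exp (-t) * u ((σ i).effort m h t) h.stock)
      (Ioi h.time) :=
    integrableOn_Ioi_exp_neg_mul h.time (hu.measurable_flow (σ i) h)
      fun t _ => hu.bound _ ((σ i).effort_mem m h t) _
  have h1 := integral_integral_lt_eq (P := Measure.pi (fun _ : Fin n => expMeasure 1))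
    (measurable_nextTime_right hl σ h) (T := h.time)
    (fun t ht => clocks_real_lt_nextTime hl σ h (le_of_lt ht)) hg
  simp only [stageValue]
  rw [h1]
  refine setIntegral_congr_fun measurableSet_Ioi fun t _ => ?_
  ring

/-- Integration over the clocks and the size of the next innovation turns the reward of a step into
a flow that is discounted by the survival function of the next innovation. -/
lemma integral_stepReward {u : ℝ → ℝ → ℝ} {v : ℝ → ℝ} {C : ℝ} (hu : FlowBound u C)
    (hv : ValueBound v C) (hF : Integrable (fun z : ℝ => z) F) (hl : 0 < lam)
    (σ : Fin n → Strategy n) (h : Hist n m) :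
    ∫ y, stepReward u v lam σ h y ∂(stepLaw n F)
      = (∫ t in Ioi h.time, Real.exp (-t) * (Real.exp (-∫ r in h.time..t, intensity lam σ h r)
          * ((∑ i, u ((σ i).effort m h t) h.stock) / n - expAfter F v h.stock)))
        + Real.exp (-h.time) * expAfter F v h.stock := by
  have hR : Integrable (fun e => (∑ i, stageValue u lam σ i h e) / n)
      (Measure.pi (fun _ : Fin n => expMeasure 1)) :=
    (integrable_finsetSum _ fun i _ => integrable_stageValue hu hl σ i h).div_const _
  simp only [stepReward]
  rw [integral_add (hR.comp_fst F) (integrable_disc_mul hv hF hl σ h),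
    integral_fun_fst (fun e => (∑ i, stageValue u lam σ i h e) / (n : ℝ)), integral_disc_mul,
    integral_disc_nextTime hl, integral_div,
    integral_finsetSum _ fun i _ => integrable_stageValue hu hl σ i h]
  simp_rw [integral_stageValue hu hl]
  have hi : ∀ i ∈ (Finset.univ : Finset (Fin n)), Integrable (fun t => Real.exp (-t) *
      (Real.exp (-∫ r in h.time..t, intensity lam σ h r) * u ((σ i).effort m h t) h.stock))
      (volume.restrict (Ioi h.time)) := fun i _ =>
    integrable_survival_mul hl σ h (hu.measurable_flow (σ i) h)
      fun t => hu.bound _ ((σ i).effort_mem m h t) _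
  have h1 : IntegrableOn (fun t => Real.exp (-t) *
      (Real.exp (-∫ r in h.time..t, intensity lam σ h r) * 1)) (Ioi h.time) :=
    integrable_survival_mul hl σ h measurable_const (K := 1) (by simp)
  rw [← integral_finsetSum _ hi, ← integral_div]
  have h2 : ∀ t, Real.exp (-t) * (Real.exp (-∫ r in h.time..t, intensity lam σ h r)
          * ((∑ i, u ((σ i).effort m h t) h.stock) / n - expAfter F v h.stock))
      = (∑ i, Real.exp (-t) * (Real.exp (-∫ r in h.time..t, intensity lam σ h r)
          * u ((σ i).effort m h t) h.stock)) / n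
        - Real.exp (-t) * (Real.exp (-∫ r in h.time..t, intensity lam σ h r) * 1)
          * expAfter F v h.stock := by
    intro t
    rw [← Finset.mul_sum, ← Finset.mul_sum]
    ring
  simp_rw [h2]
  rw [integral_sub ((integrable_finsetSum _ hi).div_const _) (h1.mul_const _), integral_mul_const]
  have h3 : ∫ t in Ioi h.time, Real.exp (-t) *
      (Real.exp (-∫ r in h.time..t, intensity lam σ h r) * 1)
      = ∫ t in Ioi h.time, Real.exp (-∫ r in h.time..t, intensity lam σ h r) * Real.exp (-t) := by
    congr 1
    funext t
    ring
  rw [h3, measureReal_def, measure_univ]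
  simp only [ENNReal.toReal_one, one_smul]
  ring

/-- Average over the agents of a Hamilton-Jacobi-Bellman inequality; efforts may differ. -/
lemma average_flow_eq (u : ℝ → ℝ → ℝ) (lam w W : ℝ) (σ : Fin n → Strategy n) (h : Hist n m)
    (t : ℝ) :
    (1 + intensity lam σ h t) * (w - W) - ((∑ i, u ((σ i).effort m h t) h.stock) / n - W)
      = (∑ i, (w - (u ((σ i).effort m h t) h.stock
          + (σ i).effort m h t * lam * n * (W - w)))) / n := by
  have hn : (n : ℝ) ≠ 0 := Nat.cast_ne_zero.2 (NeZero.ne n)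
  have h1 : ∑ i, (σ i).effort m h t * lam * n * (W - w)
      = n * ((W - w) * intensity lam σ h t) := by
    simp only [intensity, Finset.mul_sum]
    exact Finset.sum_congr rfl fun i _ => by ring
  rw [Finset.sum_sub_distrib, Finset.sum_add_distrib, h1]
  simp only [Finset.sum_const, Finset.card_univ, Fintype.card_fin, nsmul_eq_mul]
  field_simp
  ring

/-- A supersolution of the Hamilton-Jacobi-Bellman equation bounds the expected reward of a
step, whatever the agents do. -/
lemma integral_stepReward_le {u : ℝ → ℝ → ℝ} {v : ℝ → ℝ} {C : ℝ} (hu : FlowBound u C)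
    (hv : ValueBound v C) (hF : Integrable (fun z : ℝ => z) F) (hl : 0 < lam)
    (hHJB : ∀ x, ∀ a ∈ Icc (0 : ℝ) 1, u a x + a * lam * n * (expAfter F v x - v x) ≤ v x)
    (σ : Fin n → Strategy n) (h : Hist n m) :
    ∫ y, stepReward u v lam σ h y ∂(stepLaw n F) ≤ Real.exp (-h.time) * v h.stock := by
  set W := expAfter F v h.stock with hW
  have hmu : Measurable fun t => (∑ i, u ((σ i).effort m h t) h.stock) / n :=
    (Finset.measurable_sum _ fun i _ => hu.measurable_flow (σ i) h).div_const _
  have hbu : ∀ t, |(∑ i, u ((σ i).effort m h t) h.stock) / n| ≤ C * (1 + |h.stock|) := by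
    intro t
    have hn : (0 : ℝ) < n := Nat.cast_pos.2 (Nat.pos_of_neZero n)
    rw [abs_div, abs_of_pos hn, div_le_iff₀ hn]
    calc _ ≤ ∑ i, |u ((σ i).effort m h t) h.stock| := Finset.abs_sum_le_sum_abs _ _
      _ ≤ ∑ _i : Fin n, C * (1 + |h.stock|) :=
        Finset.sum_le_sum fun i _ => hu.bound _ ((σ i).effort_mem m h t) _
      _ = _ := by simp [mul_comm]
  have hi1 := integrable_survival_mul hl σ h (hmu.sub_const W)
    (K := C * (1 + |h.stock|) + |W|) fun t => (abs_sub _ _).trans (by gcongr; exact hbu t)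
  have hi2 := integrable_survival_mul hl σ h
    (((measurable_intensity lam σ h).const_add 1).mul_const (v h.stock - W))
    (K := (1 + lam * n) * |v h.stock - W|) fun t => by
      rw [abs_mul, abs_of_nonneg (by linarith [(intensity_mem_Icc hl σ h t).1])]
      gcongr
      exact (intensity_mem_Icc hl σ h t).2
  rw [integral_stepReward hu hv hF hl]
  have hle := setIntegral_mono_on hi1 hi2 measurableSet_Ioi fun t _ => by
    refine mul_le_mul_of_nonneg_left (mul_le_mul_of_nonneg_left ?_ (Real.exp_nonneg _))
      (Real.exp_nonneg _)
    rw [← sub_nonneg, average_flow_eq]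
    refine div_nonneg (Finset.sum_nonneg fun i _ => sub_nonneg.2 ?_) (Nat.cast_nonneg n)
    exact hHJB h.stock _ ((σ i).effort_mem m h t)
  rw [integral_survival_mul_one_add hl] at hle
  linarith

lemma integral_stepReward_eq {u : ℝ → ℝ → ℝ} {v : ℝ → ℝ} {C : ℝ} (hu : FlowBound u C)
    (hv : ValueBound v C) (hF : Integrable (fun z : ℝ => z) F) (hl : 0 < lam)
    {σ : Fin n → Strategy n} {h : Hist n m}
    (hHJB : ∀ i t, u ((σ i).effort m h t) h.stock
      + (σ i).effort m h t * lam * n * (expAfter F v h.stock - v h.stock) = v h.stock) :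
    ∫ y, stepReward u v lam σ h y ∂(stepLaw n F) = Real.exp (-h.time) * v h.stock := by
  rw [integral_stepReward hu hv hF hl]
  have hflow : ∀ t, (∑ i, u ((σ i).effort m h t) h.stock) / n - expAfter F v h.stock
      = (1 + intensity lam σ h t) * (v h.stock - expAfter F v h.stock) := by
    intro t
    have h1 := average_flow_eq u lam (v h.stock) (expAfter F v h.stock) σ h t
    simp_rw [hHJB] at h1
    simp at h1
    linarith
  simp_rw [hflow]
  rw [integral_survival_mul_one_add hl]
  ring

/-- As innovations are produced at rate at most `lam * n`, the expected discount factor shrinks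
geometrically from one innovation to the next. -/
lemma integral_disc_nextTime_le (hl : 0 < lam) (σ : Fin n → Strategy n) (h : Hist n m) :
    ∫ e, disc (nextTime lam σ h e) ∂(Measure.pi (fun _ : Fin n => expMeasure 1))
      ≤ lam * n / (1 + lam * n) * Real.exp (-h.time) := by
  have hpos : 0 < 1 + lam * n := by positivity
  rw [integral_disc_nextTime hl]
  have hi1 := integrable_survival_mul hl σ h
    (((measurable_intensity lam σ h).const_add 1).mul_const 1)
    (K := 1 + lam * n) fun t => by
      have := intensity_mem_Icc hl σ h t
      rw [mul_one, abs_of_nonneg (by linarith [this.1])]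
      linarith [this.2]
  have hi2 := integrable_survival_mul hl σ h (g := fun _ => 1 + lam * n) measurable_const
    (K := 1 + lam * n) fun t => (abs_of_pos hpos).le
  have hle := setIntegral_mono_on hi1 hi2 measurableSet_Ioi fun t _ => by
    refine mul_le_mul_of_nonneg_left (mul_le_mul_of_nonneg_left ?_ (Real.exp_nonneg _))
      (Real.exp_nonneg _)
    linarith [(intensity_mem_Icc hl σ h t).2]
  rw [integral_survival_mul_one_add hl] at hle
  have h3 : ∫ t in Ioi h.time, Real.exp (-t) *
      (Real.exp (-∫ r in h.time..t, intensity lam σ h r) * (1 + lam * n))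
      = (1 + lam * n) *
        ∫ t in Ioi h.time, Real.exp (-∫ r in h.time..t, intensity lam σ h r) * Real.exp (-t) := by
    rw [← integral_const_mul]
    congr 1
    funext t
    ring
  rw [h3, mul_one] at hle
  rw [div_mul_eq_mul_div, le_div_iff₀ hpos]
  nlinarith

end Continuation

/-! ### The path of play as a function of the noise -/

section Path

variable {n m : ℕ} {lam : ℝ} {F : Measure ℝ} [IsProbabilityMeasure F]

lemma path_succ_elim (lam : ℝ) (σ : Fin n → Strategy n) (x₀ : ℝ) (ω : Noise n)
    (g : Hist n (m + 1) → ℝ) :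
    (path lam σ x₀ ω (m + 1)).elim 0 g
      = (path lam σ x₀ ω m).elim 0 fun h => (nextHist lam σ h (ω m).1 (ω m).2).elim 0 g := by
  rw [path]
  cases path lam σ x₀ ω m <;> rfl

lemma path_update (lam : ℝ) (σ : Fin n → Strategy n) (x₀ : ℝ) (ω : Noise n) (k : ℕ)
    (y : (Fin n → ℝ) × ℝ) :
    ∀ m ≤ k, path lam σ x₀ (Function.update ω k y) m = path lam σ x₀ ω m
  | 0, _ => rfl
  | m + 1, hm => by
    rw [path, path, path_update lam σ x₀ ω k y m (by omega),
      Function.update_of_ne (by omega : m ≠ k)]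

instance (n : ℕ) : IsProbabilityMeasure (noiseLaw n F) := by
  unfold noiseLaw
  infer_instance

/-- Replacing one coordinate of the noise by an independent copy does not change its law. -/
lemma measurePreserving_update (n k : ℕ) (F : Measure ℝ) [IsProbabilityMeasure F] :
    MeasurePreserving (fun p : Noise n × ((Fin n → ℝ) × ℝ) => Function.update p.1 k p.2)
      ((noiseLaw n F).prod (stepLaw n F)) (noiseLaw n F) := by
  have hmeas : Measurable (fun p : Noise n × ((Fin n → ℝ) × ℝ) => Function.update p.1 k p.2) := by
    refine measurable_pi_iff.2 fun j => ?_
    by_cases hj : j = k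
    · subst hj
      simpa using measurable_snd
    · simp only [Function.update_of_ne hj]
      exact (measurable_pi_apply j).comp measurable_fst
  refine ⟨hmeas, ?_⟩
  refine Measure.eq_infinitePi _ fun s t ht => ?_
  have hpre : (fun p : Noise n × ((Fin n → ℝ) × ℝ) => Function.update p.1 k p.2) ⁻¹'
      ((s : Set ℕ).pi t)
      = ((s.erase k : Finset ℕ) : Set ℕ).pi t ×ˢ (if k ∈ s then t k else univ) := by
    ext p
    simp only [mem_preimage, Set.mem_pi, Finset.mem_coe, mem_prod, Finset.mem_erase]
    constructor
    · intro hp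
      refine ⟨fun j hj => ?_, ?_⟩
      · have := hp j hj.2
        rwa [Function.update_of_ne hj.1] at this
      · split_ifs with hk
        · simpa using hp k hk
        · trivial
    · rintro ⟨h1, h2⟩ j hj
      by_cases hjk : j = k
      · subst hjk
        rw [if_pos hj] at h2
        simpa using h2
      · rw [Function.update_of_ne hjk]
        exact h1 j ⟨hjk, hj⟩
  rw [Measure.map_apply hmeas (MeasurableSet.pi s.countable_toSet fun i _ => ht i), hpre,
    Measure.prod_prod, noiseLaw, Measure.infinitePi_pi _ fun i _ => ht i]
  split_ifs with hk
  · rw [mul_comm, Finset.mul_prod_erase s (fun i => stepLaw n F (t i)) hk]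
  · rw [Finset.erase_eq_of_notMem hk, measure_univ, mul_one]

/-- The producer of the next innovation, if there is one; the lowest index in case of a tie. -/
noncomputable def firstAgent [NeZero n] (lam : ℝ) (σ : Fin n → Strategy n) (h : Hist n m)
    (e : Fin n → ℝ) : Fin n :=
  open Classical in
  Fin.find (fun i => agentArrival lam σ h e i = nextTime lam σ h e)
    (exists_agentArrival_eq_nextTime lam σ h e)

/-- The history following `h` if there is a next innovation. -/
noncomputable def succHist [NeZero n] (lam : ℝ) (σ : Fin n → Strategy n) (h : Hist n m)
    (e : Fin n → ℝ) (z : ℝ) : Hist n (m + 1) :=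
  (h.1, Fin.snoc h.2 ((nextTime lam σ h e).toReal, z, firstAgent lam σ h e))

lemma nextHist_eq_none {σ : Fin n → Strategy n} {h : Hist n m} {e : Fin n → ℝ}
    (ht : nextTime lam σ h e = ⊤) (z : ℝ) : nextHist lam σ h e z = none := by
  rw [nextHist, dif_neg]
  simp [ht]

lemma nextHist_eq_some [NeZero n] {σ : Fin n → Strategy n} {h : Hist n m} {e : Fin n → ℝ}
    (ht : nextTime lam σ h e ≠ ⊤) (z : ℝ) :
    nextHist lam σ h e z = some (succHist lam σ h e z) := by
  obtain ⟨i, hi⟩ := exists_agentArrival_eq_nextTime lam σ h e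
  rw [nextHist, dif_pos ⟨i, hi, ht⟩, succHist, firstAgent]
  congr 6
  funext j
  simp [ht]

lemma time_succHist [NeZero n] (σ : Fin n → Strategy n) (h : Hist n m) (e : Fin n → ℝ) (z : ℝ) :
    (succHist lam σ h e z).time = (nextTime lam σ h e).toReal := by
  simp [succHist, Hist.time]

lemma stock_succHist [NeZero n] (σ : Fin n → Strategy n) (h : Hist n m) (e : Fin n → ℝ) (z : ℝ) :
    (succHist lam σ h e z).stock = h.stock + z := by
  simp [succHist, Hist.stock, Fin.sum_univ_castSucc, add_assoc]

lemma nextHist_elim_disc [NeZero n] (σ : Fin n → Strategy n) (h : Hist n m) (e : Fin n → ℝ)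
    (z : ℝ) (v : ℝ → ℝ) :
    (nextHist lam σ h e z).elim 0 (fun h' => Real.exp (-h'.time) * v h'.stock)
      = disc (nextTime lam σ h e) * v (h.stock + z) := by
  by_cases ht : nextTime lam σ h e = ⊤
  · simp [nextHist_eq_none ht, ht, disc]
  · rw [nextHist_eq_some ht]
    simp [time_succHist, stock_succHist, disc, ht]

lemma measurable_firstAgent [NeZero n] (hl : 0 < lam) (σ : Fin n → Strategy n) :
    Measurable fun p : Hist n m × (Fin n → ℝ) => firstAgent lam σ p.1 p.2 := by
  refine measurable_to_countable' fun i => ?_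
  have : (fun p : Hist n m × (Fin n → ℝ) => firstAgent lam σ p.1 p.2) ⁻¹' {i}
      = {p | agentArrival lam σ p.1 p.2 i = nextTime lam σ p.1 p.2}
        ∩ ⋂ j : Fin n, ⋂ (_ : j < i),
          {p | agentArrival lam σ p.1 p.2 j = nextTime lam σ p.1 p.2}ᶜ := by
    ext p
    simp only [mem_preimage, mem_singleton_iff, firstAgent, Fin.find_eq_iff, mem_inter_iff,
      mem_iInter, mem_compl_iff, mem_ofPred_eq]
  rw [this]
  have hm : ∀ j, MeasurableSet {p : Hist n m × (Fin n → ℝ) |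
      agentArrival lam σ p.1 p.2 j = nextTime lam σ p.1 p.2} := fun j =>
    measurableSet_eq_fun (measurable_agentArrival hl σ j) (measurable_nextTime hl σ)
  exact (hm i).inter (MeasurableSet.iInter fun j => MeasurableSet.iInter fun _ => (hm j).compl)

lemma measurable_succHist [NeZero n] (hl : 0 < lam) (σ : Fin n → Strategy n) :
    Measurable fun p : Hist n m × ((Fin n → ℝ) × ℝ) => succHist lam σ p.1 p.2.1 p.2.2 := by
  have hfst : Measurable fun p : Hist n m × ((Fin n → ℝ) × ℝ) => (p.1, p.2.1) :=
    measurable_fst.prodMk (measurable_fst.comp measurable_snd)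
  have hT := ((measurable_nextTime (m := m) hl σ).comp hfst).ereal_toReal
  have hA := (measurable_firstAgent (m := m) hl σ).comp hfst
  have hE := hT.prodMk ((measurable_snd.comp measurable_snd).prodMk hA)
  refine (measurable_fst.comp measurable_fst).prodMk (measurable_pi_iff.2 fun j => ?_)
  refine Fin.lastCases ?_ (fun j => ?_) j
  · simp only [Fin.snoc_last]
    exact hE
  · simp only [Fin.snoc_castSucc]
    exact (measurable_pi_apply j).comp (measurable_snd.comp measurable_fst)

/-- Functions of the history reached upon the `m`-th innovation (extended by `0` if there is none)
are measurable. -/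
lemma measurable_path_elim [NeZero n] (hl : 0 < lam) (σ : Fin n → Strategy n) (x₀ : ℝ) :
    ∀ (m : ℕ) {f : Hist n m × Noise n → ℝ}, Measurable f →
      Measurable fun ω => (path lam σ x₀ ω m).elim 0 fun h => f (h, ω)
  | 0, f, hf => hf.comp (measurable_const.prodMk measurable_id)
  | m + 1, f, hf => by
    simp_rw [path_succ_elim]
    refine measurable_path_elim hl σ x₀ m
      (f := fun p => (nextHist lam σ p.1 (p.2 m).1 (p.2 m).2).elim 0 fun h => f (h, p.2)) ?_
    have hm : Measurable fun p : Hist n m × Noise n => p.2 m :=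
      (measurable_pi_apply m).comp measurable_snd
    have hT : Measurable fun p : Hist n m × Noise n => nextTime lam σ p.1 (p.2 m).1 :=
      Measurable.iInf fun i => (measurable_agentArrival (m := m) hl σ i).comp
        (measurable_fst.prodMk (measurable_fst.comp hm))
    have hS : Measurable fun p : Hist n m × Noise n =>
        succHist lam σ p.1 (p.2 m).1 (p.2 m).2 := by
      have h1 := measurable_succHist (m := m) hl σ
      have h2 := h1.comp (measurable_fst.prodMk hm)
      exact h2
    have heq : (fun p : Hist n m × Noise n =>
        (nextHist lam σ p.1 (p.2 m).1 (p.2 m).2).elim 0 fun h => f (h, p.2))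
        = fun p => open Classical in if nextTime lam σ p.1 (p.2 m).1 = ⊤ then 0
            else f (succHist lam σ p.1 (p.2 m).1 (p.2 m).2, p.2) := by
      funext p
      split_ifs with ht
      · simp [nextHist_eq_none ht]
      · simp [nextHist_eq_some ht]
    rw [heq]
    exact Measurable.ite (hT (measurableSet_singleton ⊤)) measurable_const
      (hf.comp (hS.prodMk measurable_snd))

/-- The noise that determines the next innovation is independent of the current history. -/
lemma integral_path_elim [NeZero n] (hl : 0 < lam) (σ : Fin n → Strategy n) (x₀ : ℝ)
    {f : Hist n m × ((Fin n → ℝ) × ℝ) → ℝ} (hf : Measurable f)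
    (hsec : ∀ h, Integrable (fun y => f (h, y)) (stepLaw n F))
    (hnorm : Integrable (fun ω => (path lam σ x₀ ω m).elim 0
      fun h => ∫ y, |f (h, y)| ∂(stepLaw n F)) (noiseLaw n F)) :
    Integrable (fun ω => (path lam σ x₀ ω m).elim 0 fun h => f (h, ω m)) (noiseLaw n F) ∧
    ∫ ω, (path lam σ x₀ ω m).elim 0 (fun h => f (h, ω m)) ∂(noiseLaw n F)
      = ∫ ω, (path lam σ x₀ ω m).elim 0 (fun h => ∫ y, f (h, y) ∂(stepLaw n F))
          ∂(noiseLaw n F) := by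
  set Φ : Noise n → ℝ := fun ω => (path lam σ x₀ ω m).elim 0 fun h => f (h, ω m) with hΦ
  have hΦm : Measurable Φ :=
    measurable_path_elim hl σ x₀ m (f := fun p : Hist n m × Noise n => f (p.1, p.2 m))
      (hf.comp (measurable_fst.prodMk ((measurable_pi_apply m).comp measurable_snd)))
  have mp := measurePreserving_update n m F
  have hup : ∀ (ω : Noise n) (y : (Fin n → ℝ) × ℝ), Φ (Function.update ω m y)
      = (path lam σ x₀ ω m).elim 0 fun h => f (h, y) := by
    intro ω y
    simp only [hΦ, path_update lam σ x₀ ω m y m le_rfl, Function.update_self]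
  have hint : Integrable (fun p : Noise n × ((Fin n → ℝ) × ℝ) => Φ (Function.update p.1 m p.2))
      ((noiseLaw n F).prod (stepLaw n F)) := by
    have hΦu : Measurable fun p : Noise n × ((Fin n → ℝ) × ℝ) => Φ (Function.update p.1 m p.2) :=
      hΦm.comp mp.measurable
    rw [integrable_prod_iff hΦu.aestronglyMeasurable]
    refine ⟨Eventually.of_forall fun ω => ?_, ?_⟩
    · simp only [hup]
      cases path lam σ x₀ ω m with
      | none => exact integrable_zero _ _ _
      | some h => exact hsec h
    · refine hnorm.congr (Eventually.of_forall fun ω => ?_)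
      simp only [hup]
      cases path lam σ x₀ ω m with
      | none => simp
      | some h => simp [Real.norm_eq_abs]
  refine ⟨(mp.integrable_comp hΦm.aestronglyMeasurable).1 hint, ?_⟩
  calc ∫ ω, Φ ω ∂(noiseLaw n F)
      = ∫ p, Φ (Function.update p.1 m p.2) ∂((noiseLaw n F).prod (stepLaw n F)) := by
        conv_lhs => rw [← mp.map_eq]
        exact integral_map mp.measurable.aemeasurable hΦm.aestronglyMeasurable
    _ = ∫ ω, ∫ y, Φ (Function.update ω m y) ∂(stepLaw n F) ∂(noiseLaw n F) :=
        integral_prod _ hint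
    _ = _ := by
        refine integral_congr_ae (Eventually.of_forall fun ω => ?_)
        simp only [hup]
        cases path lam σ x₀ ω m with
        | none => simp
        | some h => rfl

end Path

/-! ### Welfare and solutions of the Hamilton-Jacobi-Bellman equation -/

section Verification

variable {n : ℕ} {lam : ℝ} {F : Measure ℝ} [IsProbabilityMeasure F]

/-- A weight of linear growth whose discounted expectation contracts from one innovation to the
next. One innovation raises the expectation of `1 + |X|` by at most `E |z|`; the constant is large
enough for the contraction of the discount factor, by `lam * n / (1 + lam * n)`, to outweigh
this. -/
noncomputable def weight (n : ℕ) (lam : ℝ) (F : Measure ℝ) (x : ℝ) : ℝ :=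
  1 + |x| + 2 * (lam * n) * ∫ z, |z| ∂F

/-- The contraction factor of `weight`: the midpoint of `lam * n / (1 + lam * n)` and `1`. -/
noncomputable def decay (n : ℕ) (lam : ℝ) : ℝ := (lam * n + 1 / 2) / (1 + lam * n)

lemma decay_nonneg (n : ℕ) (hl : 0 < lam) : 0 ≤ decay n lam := by
  unfold decay
  positivity

lemma decay_lt_one (n : ℕ) (hl : 0 < lam) : decay n lam < 1 := by
  have : 0 < 1 + lam * n := by positivity
  rw [decay, div_lt_one this]
  linarith

lemma one_add_abs_le_weight {F : Measure ℝ} (n : ℕ) (hl : 0 < lam) (x : ℝ) :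
    1 + |x| ≤ weight n lam F x :=
  le_add_of_nonneg_right (mul_nonneg (by positivity) (integral_nonneg fun z => abs_nonneg z))

lemma weight_nonneg {F : Measure ℝ} (n : ℕ) (hl : 0 < lam) (x : ℝ) : 0 ≤ weight n lam F x :=
  le_trans (by positivity) (one_add_abs_le_weight n hl x)

lemma valueBound_weight {F : Measure ℝ} (n : ℕ) (hl : 0 < lam) :
    ValueBound (weight n lam F) (1 + 2 * (lam * n) * ∫ z, |z| ∂F) := by
  have hI : 0 ≤ 2 * (lam * n) * ∫ z, |z| ∂F :=
    mul_nonneg (by positivity) (integral_nonneg fun z => abs_nonneg z)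
  refine ⟨by unfold weight; fun_prop, fun x => ?_⟩
  rw [abs_of_nonneg (weight_nonneg n hl x), weight]
  nlinarith [abs_nonneg x]

lemma mul_expAfter_weight_le (hF : Integrable (fun z : ℝ => z) F) (hl : 0 < lam) (x : ℝ) :
    lam * n / (1 + lam * n) * expAfter F (weight n lam F) x ≤ decay n lam * weight n lam F x := by
  set I := ∫ z, |z| ∂F with hI
  have hI0 : 0 ≤ I := integral_nonneg fun z => abs_nonneg z
  have hle : expAfter F (weight n lam F) x ≤ weight n lam F x + I := by
    have h1 : expAfter F (weight n lam F) x ≤ ∫ z, (weight n lam F x + |z|) ∂F := by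
      refine integral_mono ((valueBound_weight n hl).integrable_shift hF x)
        ((integrable_const _).add hF.abs) fun z => ?_
      simp only [weight]
      linarith [abs_add_le x z]
    rw [integral_add (integrable_const _) hF.abs] at h1
    simpa using h1
  have hpos : 0 < 1 + lam * n := by positivity
  have hln : 0 ≤ lam * n := by positivity
  have hw : 2 * (lam * n) * I ≤ weight n lam F x := by
    have := abs_nonneg x
    simp only [weight, ← hI]
    linarith
  rw [decay, div_mul_eq_mul_div, div_mul_eq_mul_div]
  refine div_le_div_of_nonneg_right ?_ hpos.le
  nlinarith [mul_le_mul_of_nonneg_left hle hln]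

/-- The discounted value `e^{-T} g(X)` of the stock `X` reached upon the `m`-th innovation, `T`
being the time of that innovation; `0` if there is none. -/
noncomputable def discounted (lam : ℝ) (σ : Fin n → Strategy n) (x₀ : ℝ) (g : ℝ → ℝ) (m : ℕ)
    (ω : Noise n) : ℝ :=
  (path lam σ x₀ ω m).elim 0 fun h => Real.exp (-h.time) * g h.stock

lemma measurable_discounted [NeZero n] (hl : 0 < lam) (σ : Fin n → Strategy n) (x₀ : ℝ) {g : ℝ → ℝ}
    (hg : Measurable g) (m : ℕ) : Measurable (discounted lam σ x₀ g m) :=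
  measurable_path_elim hl σ x₀ m
    (f := fun p : Hist n m × Noise n => Real.exp (-p.1.time) * g p.1.stock)
    (((Hist.measurable_time.comp measurable_fst).neg.exp).mul
      (hg.comp (Hist.measurable_stock.comp measurable_fst)))

lemma discounted_succ [NeZero n] (σ : Fin n → Strategy n) (x₀ : ℝ) (g : ℝ → ℝ) (m : ℕ)
    (ω : Noise n) : discounted lam σ x₀ g (m + 1) ω = (path lam σ x₀ ω m).elim 0 fun h =>
      disc (nextTime lam σ h (ω m).1) * g (h.stock + (ω m).2) := by
  simp only [discounted, path_succ_elim, nextHist_elim_disc]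

lemma discounted_weight_nonneg {F : Measure ℝ} (hl : 0 < lam) (σ : Fin n → Strategy n) (x₀ : ℝ)
    (m : ℕ) (ω : Noise n) : 0 ≤ discounted lam σ x₀ (weight n lam F) m ω := by
  unfold discounted
  cases path lam σ x₀ ω m with
  | none => exact le_rfl
  | some h => exact mul_nonneg (Real.exp_nonneg _) (weight_nonneg n hl _)

lemma measurable_disc_mul {m : ℕ} (hl : 0 < lam) (σ : Fin n → Strategy n) {g : ℝ → ℝ}
    (hg : Measurable g) : Measurable fun p : Hist n m × ((Fin n → ℝ) × ℝ) =>
      disc (nextTime lam σ p.1 p.2.1) * g (p.1.stock + p.2.2) := by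
  have h1 : Measurable fun p : Hist n m × ((Fin n → ℝ) × ℝ) => nextTime lam σ p.1 p.2.1 :=
    Measurable.iInf fun i => (measurable_agentArrival (m := m) hl σ i).comp
      (measurable_fst.prodMk (measurable_fst.comp measurable_snd))
  exact (measurable_disc.comp h1).mul (hg.comp
    ((Hist.measurable_stock.comp measurable_fst).add (measurable_snd.comp measurable_snd)))

lemma integral_disc_mul_weight_le [NeZero n] {m : ℕ} (hF : Integrable (fun z : ℝ => z) F)
    (hl : 0 < lam) (σ : Fin n → Strategy n) (h : Hist n m) :
    ∫ y : (Fin n → ℝ) × ℝ, disc (nextTime lam σ h y.1) * weight n lam F (h.stock + y.2)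
      ∂(stepLaw n F) ≤ decay n lam * (Real.exp (-h.time) * weight n lam F h.stock) := by
  have hE : 0 ≤ expAfter F (weight n lam F) h.stock :=
    integral_nonneg fun z => weight_nonneg n hl _
  rw [integral_disc_mul]
  calc _ ≤ lam * n / (1 + lam * n) * Real.exp (-h.time)
          * expAfter F (weight n lam F) h.stock :=
        mul_le_mul_of_nonneg_right (integral_disc_nextTime_le hl σ h) hE
    _ = Real.exp (-h.time) * (lam * n / (1 + lam * n)
          * expAfter F (weight n lam F) h.stock) := by ring
    _ ≤ Real.exp (-h.time) * (decay n lam * weight n lam F h.stock) :=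
        mul_le_mul_of_nonneg_left (mul_expAfter_weight_le hF hl _) (Real.exp_nonneg _)
    _ = _ := by ring

/-- The expected discounted weight decays geometrically in the number of innovations. -/
lemma integrable_discounted_weight [NeZero n] (hF : Integrable (fun z : ℝ => z) F) (hl : 0 < lam)
    (σ : Fin n → Strategy n) (x₀ : ℝ) (m : ℕ) :
    Integrable (discounted lam σ x₀ (weight n lam F) m) (noiseLaw n F) ∧
      ∫ ω, discounted lam σ x₀ (weight n lam F) m ω ∂(noiseLaw n F)
        ≤ decay n lam ^ m * weight n lam F x₀ := by
  have hw := valueBound_weight (F := F) n hl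
  induction m with
  | zero =>
    have h0 : discounted lam σ x₀ (weight n lam F) 0 = fun _ => weight n lam F x₀ := by
      funext ω
      simp [discounted, path, Hist.time, Hist.stock]
    rw [h0]
    simp
  | succ m ih =>
    set f : Hist n m × ((Fin n → ℝ) × ℝ) → ℝ := fun p =>
      disc (nextTime lam σ p.1 p.2.1) * weight n lam F (p.1.stock + p.2.2) with hf
    have hf0 : ∀ p, 0 ≤ f p := fun p => mul_nonneg (disc_nonneg _) (weight_nonneg n hl _)
    have hfm : Measurable f := measurable_disc_mul hl σ hw.meas
    have hstep : ∀ h : Hist n m, ∫ y, f (h, y) ∂(stepLaw n F)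
        ≤ decay n lam * (Real.exp (-h.time) * weight n lam F h.stock) := fun h =>
      integral_disc_mul_weight_le hF hl σ h
    have hle : ∀ ω, (path lam σ x₀ ω m).elim 0 (fun h => ∫ y, f (h, y) ∂(stepLaw n F))
        ≤ decay n lam * discounted lam σ x₀ (weight n lam F) m ω := by
      intro ω
      unfold discounted
      cases path lam σ x₀ ω m with
      | none => simp
      | some h => exact hstep h
    have hnn : ∀ ω, 0 ≤ (path lam σ x₀ ω m).elim 0 (fun h => ∫ y, f (h, y) ∂(stepLaw n F)) := by
      intro ω
      cases path lam σ x₀ ω m with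
      | none => exact le_rfl
      | some h => exact integral_nonneg fun y => hf0 _
    have hmeas : Measurable fun ω => (path lam σ x₀ ω m).elim 0
        (fun h => ∫ y, f (h, y) ∂(stepLaw n F)) :=
      measurable_path_elim hl σ x₀ m
        (f := fun p : Hist n m × Noise n => ∫ y, f (p.1, y) ∂(stepLaw n F))
        ((hfm.stronglyMeasurable.integral_prod_right').measurable.comp measurable_fst)
    have hint : Integrable (fun ω => (path lam σ x₀ ω m).elim 0
        (fun h => ∫ y, f (h, y) ∂(stepLaw n F))) (noiseLaw n F) := by
      refine (ih.1.const_mul (decay n lam)).mono' hmeas.aestronglyMeasurable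
        (Eventually.of_forall fun ω => ?_)
      rw [Real.norm_of_nonneg (hnn ω)]
      exact hle ω
    have key := integral_path_elim (F := F) hl σ x₀ hfm
      (fun h => integrable_disc_mul hw hF hl σ h) (by simpa only [abs_of_nonneg (hf0 _)] using hint)
    have hsucc : discounted lam σ x₀ (weight n lam F) (m + 1)
        = fun ω => (path lam σ x₀ ω m).elim 0 fun h => f (h, ω m) :=
      funext fun ω => discounted_succ σ x₀ _ m ω
    rw [hsucc]
    refine ⟨key.1, ?_⟩
    rw [key.2]
    calc _ ≤ ∫ ω, decay n lam * discounted lam σ x₀ (weight n lam F) m ω ∂(noiseLaw n F) :=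
          integral_mono hint (ih.1.const_mul _) hle
      _ ≤ decay n lam * (decay n lam ^ m * weight n lam F x₀) := by
          rw [integral_const_mul]
          exact mul_le_mul_of_nonneg_left ih.2 (decay_nonneg n hl)
      _ = _ := by ring

lemma abs_discounted_le {F : Measure ℝ} {v : ℝ → ℝ} {C : ℝ} (hv : ValueBound v C) (hl : 0 < lam)
    (σ : Fin n → Strategy n) (x₀ : ℝ) (m : ℕ) (ω : Noise n) :
    |discounted lam σ x₀ v m ω| ≤ C * discounted lam σ x₀ (weight n lam F) m ω := by
  have hC : 0 ≤ C := by simpa using (abs_nonneg _).trans (hv.bound 0)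
  unfold discounted
  cases path lam σ x₀ ω m with
  | none => simp
  | some h =>
    simp only [Option.elim_some]
    rw [abs_mul, abs_of_nonneg (Real.exp_nonneg _), mul_left_comm]
    exact mul_le_mul_of_nonneg_left ((hv.bound _).trans
      (mul_le_mul_of_nonneg_left (one_add_abs_le_weight n hl _) hC)) (Real.exp_nonneg _)

lemma integrable_discounted [NeZero n] {v : ℝ → ℝ} {C : ℝ} (hv : ValueBound v C)
    (hF : Integrable (fun z : ℝ => z) F) (hl : 0 < lam)
    (σ : Fin n → Strategy n) (x₀ : ℝ) (m : ℕ) :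
    Integrable (discounted lam σ x₀ v m) (noiseLaw n F) :=
  ((integrable_discounted_weight hF hl σ x₀ m).1.const_mul C).mono'
    (measurable_discounted hl σ x₀ hv.meas m).aestronglyMeasurable
    (Eventually.of_forall fun ω => abs_discounted_le hv hl σ x₀ m ω)

lemma tendsto_integral_discounted [NeZero n] {v : ℝ → ℝ} {C : ℝ} (hv : ValueBound v C)
    (hF : Integrable (fun z : ℝ => z) F) (hl : 0 < lam)
    (σ : Fin n → Strategy n) (x₀ : ℝ) :
    Tendsto (fun m => ∫ ω, discounted lam σ x₀ v m ω ∂(noiseLaw n F)) atTop (𝓝 0) := by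
  have hC : 0 ≤ C := by simpa using (abs_nonneg _).trans (hv.bound 0)
  have hlim : Tendsto (fun m => C * (decay n lam ^ m * weight n lam F x₀)) atTop
      (𝓝 (C * (0 * weight n lam F x₀))) :=
    ((tendsto_pow_atTop_nhds_zero_of_lt_one (decay_nonneg n hl)
      (decay_lt_one n hl)).mul_const _).const_mul C
  rw [zero_mul, mul_zero] at hlim
  refine squeeze_zero_norm (fun m => ?_) hlim
  have hw := integrable_discounted_weight hF hl σ x₀ m
  refine (norm_integral_le_of_norm_le (hw.1.const_mul C)
    (Eventually.of_forall fun ω => abs_discounted_le hv hl σ x₀ m ω)).trans ?_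
  rw [integral_const_mul]
  exact mul_le_mul_of_nonneg_left hw.2 hC

lemma measurable_stagePayoff [NeZero n] {u : ℝ → ℝ → ℝ} {C : ℝ} (hu : FlowBound u C) (hl : 0 < lam)
    (σ : Fin n → Strategy n) (i : Fin n) (x₀ : ℝ) (m : ℕ) :
    Measurable fun ω => stagePayoff u lam σ i x₀ ω m := by
  simp_rw [stagePayoff_eq_elim]
  have h1 := measurable_stageValue (m := m) hu hl σ i
  have h2 : Measurable fun p : Hist n m × Noise n => (p.1, (p.2 m).1) :=
    measurable_fst.prodMk
      (measurable_fst.comp ((measurable_pi_apply m).comp measurable_snd))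
  have h3 := h1.comp h2
  exact measurable_path_elim hl σ x₀ m
    (f := fun p : Hist n m × Noise n => stageValue u lam σ i p.1 (p.2 m).1) h3

lemma abs_stagePayoff_le {F : Measure ℝ} {u : ℝ → ℝ → ℝ} {C : ℝ} (hu : FlowBound u C) (hl : 0 < lam)
    (σ : Fin n → Strategy n) (i : Fin n) (x₀ : ℝ) (m : ℕ) (ω : Noise n) :
    |stagePayoff u lam σ i x₀ ω m| ≤ C * discounted lam σ x₀ (weight n lam F) m ω := by
  have hC : 0 ≤ C := by
    simpa using (abs_nonneg _).trans (hu.bound 0 (left_mem_Icc.2 zero_le_one) 0)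
  rw [stagePayoff_eq_elim]
  unfold discounted
  cases path lam σ x₀ ω m with
  | none => simp
  | some h =>
    simp only [Option.elim_some]
    refine (abs_stageValue_le hu σ i h _).trans ?_
    rw [mul_left_comm C]
    exact mul_le_mul_of_nonneg_left
      (mul_le_mul_of_nonneg_left (one_add_abs_le_weight n hl _) hC) (Real.exp_nonneg _)

lemma integrable_stagePayoff [NeZero n] {u : ℝ → ℝ → ℝ} {C : ℝ} (hu : FlowBound u C)
    (hF : Integrable (fun z : ℝ => z) F) (hl : 0 < lam)
    (σ : Fin n → Strategy n) (i : Fin n) (x₀ : ℝ) (m : ℕ) :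
    Integrable (fun ω => stagePayoff u lam σ i x₀ ω m) (noiseLaw n F) :=
  ((integrable_discounted_weight hF hl σ x₀ m).1.const_mul C).mono'
    (measurable_stagePayoff hu hl σ i x₀ m).aestronglyMeasurable
    (Eventually.of_forall fun ω => abs_stagePayoff_le hu hl σ i x₀ m ω)

lemma summable_integral_stagePayoff [NeZero n] {u : ℝ → ℝ → ℝ} {C : ℝ} (hu : FlowBound u C)
    (hF : Integrable (fun z : ℝ => z) F) (hl : 0 < lam)
    (σ : Fin n → Strategy n) (i : Fin n) (x₀ : ℝ) :
    Summable fun m => ∫ ω, stagePayoff u lam σ i x₀ ω m ∂(noiseLaw n F) := by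
  have hC : 0 ≤ C := by
    simpa using (abs_nonneg _).trans (hu.bound 0 (left_mem_Icc.2 zero_le_one) 0)
  have hs : Summable fun m => C * (decay n lam ^ m * weight n lam F x₀) :=
    ((summable_geometric_of_lt_one (decay_nonneg n hl) (decay_lt_one n hl)).mul_right _).mul_left C
  refine Summable.of_norm_bounded hs fun m => ?_
  have hw := integrable_discounted_weight hF hl σ x₀ m
  refine (norm_integral_le_of_norm_le (hw.1.const_mul C)
    (Eventually.of_forall fun ω => abs_stagePayoff_le hu hl σ i x₀ m ω)).trans ?_
  rw [integral_const_mul]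
  exact mul_le_mul_of_nonneg_left hw.2 hC

/-- Expected average payoff of the agents between the `m`-th innovation and the next one. -/
noncomputable def stageWelfare (u : ℝ → ℝ → ℝ) (lam : ℝ) (F : Measure ℝ)
    (σ : Fin n → Strategy n) (x₀ : ℝ) (m : ℕ) : ℝ :=
  (∑ i, ∫ ω, stagePayoff u lam σ i x₀ ω m ∂(noiseLaw n F)) / n

lemma hasSum_stageWelfare [NeZero n] {u : ℝ → ℝ → ℝ} {C : ℝ} (hu : FlowBound u C)
    (hF : Integrable (fun z : ℝ => z) F) (hl : 0 < lam) (σ : Fin n → Strategy n) (x₀ : ℝ) :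
    HasSum (stageWelfare u lam F σ x₀) (welfare u lam F σ x₀) :=
  (hasSum_sum fun i _ => (summable_integral_stagePayoff hu hF hl σ i x₀).hasSum).div_const _

lemma stageWelfare_add_eq [NeZero n] {u : ℝ → ℝ → ℝ} {v : ℝ → ℝ} {C : ℝ} (hu : FlowBound u C)
    (hv : ValueBound v C) (hF : Integrable (fun z : ℝ => z) F) (hl : 0 < lam)
    (σ : Fin n → Strategy n) (x₀ : ℝ) (m : ℕ) :
    Integrable (fun ω => (path lam σ x₀ ω m).elim 0
      fun h => ∫ y, stepReward u v lam σ h y ∂(stepLaw n F)) (noiseLaw n F) ∧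
    stageWelfare u lam F σ x₀ m + ∫ ω, discounted lam σ x₀ v (m + 1) ω ∂(noiseLaw n F)
      = ∫ ω, (path lam σ x₀ ω m).elim 0
          (fun h => ∫ y, stepReward u v lam σ h y ∂(stepLaw n F)) ∂(noiseLaw n F) := by
  have hw := valueBound_weight (F := F) n hl
  have hC : 0 ≤ C := by simpa using (abs_nonneg _).trans (hv.bound 0)
  have hn : (0 : ℝ) < n := Nat.cast_pos.2 (Nat.pos_of_neZero n)
  set R : Hist n m → (Fin n → ℝ) → ℝ := fun h e => (∑ i, stageValue u lam σ i h e) / n with hR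
  set f : Hist n m × ((Fin n → ℝ) × ℝ) → ℝ := fun p => stepReward u v lam σ p.1 p.2 with hf
  have hRm : Measurable fun p : Hist n m × ((Fin n → ℝ) × ℝ) => R p.1 p.2.1 := by
    refine (Finset.measurable_sum _ fun i _ => ?_).div_const _
    have h1 := measurable_stageValue (m := m) hu hl σ i
    have h2 : Measurable fun p : Hist n m × ((Fin n → ℝ) × ℝ) => (p.1, p.2.1) :=
      measurable_fst.prodMk (measurable_fst.comp measurable_snd)
    have h3 := h1.comp h2
    exact h3
  have hfm : Measurable f := hRm.add (measurable_disc_mul hl σ hv.meas)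
  have hRi : ∀ h : Hist n m, Integrable (R h) (Measure.pi (fun _ : Fin n => expMeasure 1)) :=
    fun h => (integrable_finsetSum _ fun i _ => integrable_stageValue hu hl σ i h).div_const _
  have hRb : ∀ (h : Hist n m) e, |R h e| ≤ Real.exp (-h.time) * (C * weight n lam F h.stock) := by
    intro h e
    simp only [hR]
    rw [abs_div, abs_of_pos hn, div_le_iff₀ hn]
    calc _ ≤ ∑ i, |stageValue u lam σ i h e| := Finset.abs_sum_le_sum_abs _ _
      _ ≤ ∑ _i : Fin n, Real.exp (-h.time) * (C * weight n lam F h.stock) :=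
        Finset.sum_le_sum fun i _ => (abs_stageValue_le hu σ i h e).trans
          (mul_le_mul_of_nonneg_left
            (mul_le_mul_of_nonneg_left (one_add_abs_le_weight n hl _) hC) (Real.exp_nonneg _))
      _ = _ := by simp [mul_comm]
  have hsec : ∀ h, Integrable (fun y => f (h, y)) (stepLaw n F) := fun h =>
    ((hRi h).comp_fst F).add (integrable_disc_mul hv hF hl σ h)
  have hfb : ∀ h : Hist n m, ∫ y, |f (h, y)| ∂(stepLaw n F)
      ≤ 2 * C * (Real.exp (-h.time) * weight n lam F h.stock) := by
    intro h
    have hD := integrable_disc_mul hw hF hl σ h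
    calc ∫ y, |f (h, y)| ∂(stepLaw n F)
        ≤ ∫ y, (Real.exp (-h.time) * (C * weight n lam F h.stock)
            + C * (disc (nextTime lam σ h y.1) * weight n lam F (h.stock + y.2)))
            ∂(stepLaw n F) := by
          refine integral_mono (hsec h).abs ((integrable_const _).add (hD.const_mul C))
            fun y => ?_
          refine (abs_add_le _ _).trans (add_le_add (hRb h y.1) ?_)
          rw [abs_mul, abs_of_nonneg (disc_nonneg _), mul_left_comm]
          exact mul_le_mul_of_nonneg_left ((hv.bound _).trans
            (mul_le_mul_of_nonneg_left (one_add_abs_le_weight n hl _) hC)) (disc_nonneg _)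
      _ ≤ Real.exp (-h.time) * (C * weight n lam F h.stock)
          + C * (decay n lam * (Real.exp (-h.time) * weight n lam F h.stock)) := by
          rw [integral_add (integrable_const _) (hD.const_mul C), integral_const_mul C]
          gcongr
          · simp
          · exact integral_disc_mul_weight_le hF hl σ h
      _ ≤ Real.exp (-h.time) * (C * weight n lam F h.stock)
          + C * (1 * (Real.exp (-h.time) * weight n lam F h.stock)) := by
          have := weight_nonneg (F := F) n hl h.stock
          gcongr
          exact (decay_lt_one n hl).le
      _ = _ := by ring
  have hdom : ∀ (g : Hist n m → ℝ), Measurable g →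
      (∀ h, |g h| ≤ 2 * C * (Real.exp (-h.time) * weight n lam F h.stock)) →
      Integrable (fun ω => (path lam σ x₀ ω m).elim 0 g) (noiseLaw n F) := by
    intro g hg hgb
    refine ((integrable_discounted_weight hF hl σ x₀ m).1.const_mul (2 * C)).mono'
      (measurable_path_elim hl σ x₀ m (f := fun p : Hist n m × Noise n => g p.1)
        (hg.comp measurable_fst)).aestronglyMeasurable (Eventually.of_forall fun ω => ?_)
    unfold discounted
    cases path lam σ x₀ ω m with
    | none => simp
    | some h => exact hgb h
  have hnorm := hdom (fun h => ∫ y, |f (h, y)| ∂(stepLaw n F))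
    (hfm.abs.stronglyMeasurable.integral_prod_right').measurable fun h => by
      rw [abs_of_nonneg (integral_nonneg fun y => abs_nonneg _)]
      exact hfb h
  refine ⟨hdom (fun h => ∫ y, f (h, y) ∂(stepLaw n F))
    (hfm.stronglyMeasurable.integral_prod_right').measurable
    fun h => abs_integral_le_integral_abs.trans (hfb h), ?_⟩
  rw [← (integral_path_elim hl σ x₀ hfm hsec hnorm).2, stageWelfare,
    ← integral_finsetSum _ fun i _ => integrable_stagePayoff hu hF hl σ i x₀ m, ← integral_div,
    ← integral_add ((integrable_finsetSum _
      fun i _ => integrable_stagePayoff hu hF hl σ i x₀ m).div_const _)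
      (integrable_discounted hv hF hl σ x₀ (m + 1))]
  refine integral_congr_ae (Eventually.of_forall fun ω => ?_)
  simp only [discounted_succ, stagePayoff_eq_elim]
  cases path lam σ x₀ ω m with
  | none => simp
  | some h => rfl

lemma sum_stageWelfare_tendsto [NeZero n] {u : ℝ → ℝ → ℝ} {v : ℝ → ℝ} {C : ℝ} (hu : FlowBound u C)
    (hv : ValueBound v C) (hF : Integrable (fun z : ℝ => z) F) (hl : 0 < lam)
    (σ : Fin n → Strategy n) (x₀ : ℝ) :
    Tendsto (fun M => ∑ m ∈ Finset.range M, stageWelfare u lam F σ x₀ m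
      + ∫ ω, discounted lam σ x₀ v M ω ∂(noiseLaw n F)) atTop (𝓝 (welfare u lam F σ x₀)) := by
  simpa using (hasSum_stageWelfare hu hF hl σ x₀).tendsto_sum_nat.add
    (tendsto_integral_discounted hv hF hl σ x₀)

lemma integral_discounted_zero (v : ℝ → ℝ) (σ : Fin n → Strategy n) (x₀ : ℝ) :
    ∫ ω, discounted lam σ x₀ v 0 ω ∂(noiseLaw n F) = v x₀ := by
  simp [discounted, path, Hist.time, Hist.stock]

/-- A supersolution `v` of the Hamilton-Jacobi-Bellman equation bounds the welfare of every
strategy profile. -/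
theorem welfare_le_of_supersolution [NeZero n] {u : ℝ → ℝ → ℝ} {v : ℝ → ℝ} {C : ℝ}
    (hu : FlowBound u C) (hv : ValueBound v C) (hF : Integrable (fun z : ℝ => z) F) (hl : 0 < lam)
    (hHJB : ∀ x, ∀ a ∈ Icc (0 : ℝ) 1, u a x + a * lam * n * (expAfter F v x - v x) ≤ v x)
    (σ : Fin n → Strategy n) (x₀ : ℝ) : welfare u lam F σ x₀ ≤ v x₀ := by
  have hstep : ∀ m, stageWelfare u lam F σ x₀ m
      + ∫ ω, discounted lam σ x₀ v (m + 1) ω ∂(noiseLaw n F)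
      ≤ ∫ ω, discounted lam σ x₀ v m ω ∂(noiseLaw n F) := by
    intro m
    have h1 := stageWelfare_add_eq hu hv hF hl σ x₀ m
    rw [h1.2]
    refine integral_mono h1.1 (integrable_discounted hv hF hl σ x₀ m) fun ω => ?_
    simp only [discounted]
    cases path lam σ x₀ ω m with
    | none => exact le_rfl
    | some h => exact integral_stepReward_le hu hv hF hl hHJB σ h
  refine le_of_tendsto (sum_stageWelfare_tendsto hu hv hF hl σ x₀)
    (Eventually.of_forall fun M => ?_)
  induction M with
  | zero => simp [integral_discounted_zero]
  | succ M ih =>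
    rw [Finset.sum_range_succ]
    linarith [hstep M]

/-- If efforts attain the maximum in the Hamilton-Jacobi-Bellman equation after every history, then
welfare equals its solution. -/
theorem welfare_eq_of_solution [NeZero n] {u : ℝ → ℝ → ℝ} {v : ℝ → ℝ} {C : ℝ} (hu : FlowBound u C)
    (hv : ValueBound v C) (hF : Integrable (fun z : ℝ => z) F) (hl : 0 < lam)
    {σ : Fin n → Strategy n}
    (hHJB : ∀ m (h : Hist n m) i t, u ((σ i).effort m h t) h.stock
      + (σ i).effort m h t * lam * n * (expAfter F v h.stock - v h.stock) = v h.stock)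
    (x₀ : ℝ) : welfare u lam F σ x₀ = v x₀ := by
  have hstep : ∀ m, stageWelfare u lam F σ x₀ m
      + ∫ ω, discounted lam σ x₀ v (m + 1) ω ∂(noiseLaw n F)
      = ∫ ω, discounted lam σ x₀ v m ω ∂(noiseLaw n F) := by
    intro m
    rw [(stageWelfare_add_eq hu hv hF hl σ x₀ m).2]
    refine integral_congr_ae (Eventually.of_forall fun ω => ?_)
    simp only [discounted]
    cases path lam σ x₀ ω m with
    | none => rfl
    | some h => exact integral_stepReward_eq hu hv hF hl fun i t => hHJB m h i t
  refine tendsto_nhds_unique (sum_stageWelfare_tendsto hu hv hF hl σ x₀)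
    (tendsto_const_nhds.congr fun M => ?_)
  induction M with
  | zero => simp [integral_discounted_zero]
  | succ M ih =>
    rw [Finset.sum_range_succ]
    linarith [hstep M]

end Verification

/-! ### Maximisation over effort -/

section Maximisation

/-- The maximum of `G x a` over `a ∈ [0,r]`. -/
noncomputable def maxUpTo (G : ℝ → ℝ → ℝ) (r x : ℝ) : ℝ := sSup (G x '' Icc 0 r)

variable {G : ℝ → ℝ → ℝ} (hG : Continuous (Function.uncurry G))
include hG

lemma continuous_maxUpTo (r : ℝ) : Continuous (maxUpTo G r) :=
  isCompact_Icc.continuous_sSup hG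

lemma le_maxUpTo {r x a : ℝ} (ha : a ∈ Icc 0 r) : G x a ≤ maxUpTo G r x :=
  le_csSup (isCompact_Icc.image (hG.comp (Continuous.prodMk_right x))).bddAbove
    (mem_image_of_mem _ ha)

lemma exists_maxUpTo_eq {r : ℝ} (hr : 0 ≤ r) (x : ℝ) : ∃ a ∈ Icc 0 r, maxUpTo G r x = G x a :=
  isCompact_Icc.exists_sSup_image_eq (nonempty_Icc.2 hr)
    (hG.comp (Continuous.prodMk_right x)).continuousOn

/-- The smallest maximiser of a jointly continuous function is a measurable function of the
parameter: it is lower semicontinuous. -/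
lemma exists_measurable_isLeast_isMaxOn :
    ∃ α : ℝ → ℝ, Measurable α ∧
      ∀ x, IsLeast {a | a ∈ Icc (0 : ℝ) 1 ∧ IsMaxOn (G x) (Icc 0 1) a} (α x) := by
  have hset : ∀ x, {a | a ∈ Icc (0 : ℝ) 1 ∧ IsMaxOn (G x) (Icc 0 1) a}
      = Icc 0 1 ∩ {a | maxUpTo G 1 x ≤ G x a} := by
    intro x
    ext a
    refine and_congr_right fun ha => ?_
    rw [isMaxOn_iff, mem_ofPred_eq]
    constructor
    · intro h
      obtain ⟨a', ha', he⟩ := exists_maxUpTo_eq hG zero_le_one x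
      rw [he]
      exact h a' ha'
    · exact fun h a' ha' => (le_maxUpTo hG ha').trans h
  have hleast : ∀ x, ∃ a, IsLeast {a | a ∈ Icc (0 : ℝ) 1 ∧ IsMaxOn (G x) (Icc 0 1) a} a := by
    intro x
    rw [hset]
    refine (isCompact_Icc.inter_right (isClosed_le continuous_const
      (hG.comp (Continuous.prodMk_right x)))).exists_isLeast ?_
    obtain ⟨a, ha, he⟩ := exists_maxUpTo_eq hG zero_le_one x
    exact ⟨a, ha, he.le⟩
  choose α hα using hleast
  refine ⟨α, measurable_of_Iic fun r => ?_, hα⟩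
  -- `α x ≤ r` holds if and only if the maximum over `[0,1]` is attained on `[0, min r 1]`.
  by_cases hr : r < 0
  · have : α ⁻¹' Iic r = ∅ := by
      refine eq_empty_of_forall_notMem fun x hx => ?_
      have h1 := (hα x).1.1.1
      have h2 : α x ≤ r := hx
      linarith
    rw [this]
    exact MeasurableSet.empty
  · have hm : 0 ≤ min r 1 := le_min (not_lt.1 hr) zero_le_one
    have : α ⁻¹' Iic r = {x | maxUpTo G 1 x ≤ maxUpTo G (min r 1) x} := by
      ext x
      simp only [mem_preimage, mem_Iic, mem_ofPred_eq]
      have hx := hα x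
      rw [hset] at hx
      constructor
      · intro h
        exact hx.1.2.trans (le_maxUpTo hG ⟨hx.1.1.1, le_min h hx.1.1.2⟩)
      · intro h
        obtain ⟨a, ha, he⟩ := exists_maxUpTo_eq hG hm x
        rw [he] at h
        exact (hx.2 ⟨⟨ha.1, ha.2.trans (min_le_right _ _)⟩, h⟩).trans
          (ha.2.trans (min_le_left _ _))
    rw [this]
    exact (isClosed_le (continuous_maxUpTo hG 1) (continuous_maxUpTo hG _)).measurableSet

end Maximisation

/-! ### Existence of a solution -/

section HJB

open scoped BoundedContinuousFunction

variable {n : ℕ} {u : ℝ → ℝ → ℝ} {lam : ℝ} {F : Measure ℝ} [IsProbabilityMeasure F]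

lemma continuous_expAfter_bounded (w : ℝ →ᵇ ℝ) : Continuous (expAfter F w) := by
  refine continuous_of_dominated (bound := fun _ => ‖w‖)
    (fun x => (w.continuous.comp (continuous_const.add continuous_id)).aestronglyMeasurable)
    (fun x => Eventually.of_forall fun _ => w.norm_coe_le_norm _) (integrable_const _)
    (Eventually.of_forall fun _ => w.continuous.comp (continuous_id.add continuous_const))

lemma integrable_shift_bounded (w : ℝ →ᵇ ℝ) (x : ℝ) : Integrable (fun z => w (x + z)) F :=
  (integrable_const ‖w‖).mono'
    (w.continuous.comp (continuous_const.add continuous_id)).aestronglyMeasurable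
    (Eventually.of_forall fun _ => w.norm_coe_le_norm _)

lemma abs_expAfter_le (w : ℝ →ᵇ ℝ) (x : ℝ) : |expAfter F w x| ≤ ‖w‖ := by
  have := norm_integral_le_of_norm_le_const (μ := F) (f := fun z => w (x + z)) (C := ‖w‖)
    (Eventually.of_forall fun z => w.norm_coe_le_norm _)
  simpa [expAfter] using this

lemma expAfter_le_add (w w' : ℝ →ᵇ ℝ) (x : ℝ) :
    expAfter F w x ≤ expAfter F w' x + dist w w' := by
  have h : expAfter F w x ≤ ∫ z, (w' (x + z) + dist w w') ∂F := by
    refine integral_mono (integrable_shift_bounded w x)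
      ((integrable_shift_bounded w' x).add (integrable_const _)) fun z => ?_
    have := (abs_le.1 ((Real.dist_eq _ _).symm.le.trans (w.dist_coe_le_dist (g := w') (x + z)))).2
    linarith
  rw [integral_add (integrable_shift_bounded w' x) (integrable_const _)] at h
  simpa [expAfter] using h

/-- The maximand of the fixed-point equation for `w = v - b`, `b = u 0`. The term
`lam * n * (1 - a) * w x` stands for innovations of size zero that top up the total rate to
`lam * n`, so that the division is by `1 + lam * n` rather than by `1 + a * lam * n`, and the
contraction factor does not depend on effort. -/
noncomputable def bellman (n : ℕ) (u : ℝ → ℝ → ℝ) (lam : ℝ) (F : Measure ℝ) (w : ℝ → ℝ)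
    (x a : ℝ) : ℝ :=
  (a * lam * n * (expAfter F (u 0) x - u 0 x) - (u 0 x - u a x)
    + lam * n * (a * expAfter F w x + (1 - a) * w x)) / (1 + lam * n)

/-- The assumptions on the flow payoff that make the control problem well posed: benefits are
nondecreasing and Lipschitz, and effort is costly. -/
structure Regular (u : ℝ → ℝ → ℝ) (K : NNReal) : Prop where
  cont : Continuous (Function.uncurry u)
  lip : LipschitzWith K (u 0)
  mono : Monotone (u 0)
  cost_nonneg : ∀ a ∈ Icc (0 : ℝ) 1, ∀ x, u a x ≤ u 0 x

variable {K : NNReal}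

lemma Regular.integrable_benefit (hu : Regular u K) (hF : Integrable (fun z : ℝ => z) F) (x : ℝ) :
    Integrable (fun z => u 0 (x + z)) F := by
  refine ((integrable_const |u 0 x|).add (hF.abs.const_mul (K : ℝ))).mono'
    (hu.lip.continuous.comp (continuous_const.add continuous_id)).aestronglyMeasurable
    (Eventually.of_forall fun z => ?_)
  have h1 := hu.lip.dist_le_mul (x + z) x
  rw [Real.dist_eq, Real.dist_eq, add_sub_cancel_left] at h1
  rw [Real.norm_eq_abs]
  simp only [Pi.add_apply]
  linarith [abs_sub_abs_le_abs_sub (u 0 (x + z)) (u 0 x)]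

lemma Regular.continuous_expAfter_benefit (hu : Regular u K)
    (hF : Integrable (fun z : ℝ => z) F) : Continuous (expAfter F (u 0)) := by
  have : LipschitzWith K (expAfter F (u 0)) := by
    refine LipschitzWith.of_dist_le_mul fun x y => ?_
    rw [Real.dist_eq, expAfter, expAfter,
      ← integral_sub (hu.integrable_benefit hF x) (hu.integrable_benefit hF y)]
    have := norm_integral_le_of_norm_le_const (μ := F)
      (f := fun z => u 0 (x + z) - u 0 (y + z)) (C := K * dist x y)
      (Eventually.of_forall fun z => by
        have := hu.lip.dist_le_mul (x + z) (y + z)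
        rwa [dist_add_right, Real.dist_eq] at this)
    simpa using this
  exact this.continuous

lemma Regular.expAfter_benefit_sub_mem (hu : Regular u K) (hF : Integrable (fun z : ℝ => z) F)
    (hpos : ∀ᵐ z ∂F, 0 < z) (x : ℝ) :
    expAfter F (u 0) x - u 0 x ∈ Icc 0 (K * ∫ z, |z| ∂F) := by
  have hi := hu.integrable_benefit hF x
  have heq : expAfter F (u 0) x - u 0 x = ∫ z, (u 0 (x + z) - u 0 x) ∂F := by
    rw [integral_sub hi (integrable_const _)]
    simp [expAfter]
  rw [heq]
  constructor
  · refine integral_nonneg_of_ae ?_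
    filter_upwards [hpos] with z hz
    exact sub_nonneg.2 (hu.mono (by linarith))
  · rw [← integral_const_mul]
    refine integral_mono (hi.sub (integrable_const _)) (hF.abs.const_mul _) fun z => ?_
    have h1 := hu.lip.dist_le_mul (x + z) x
    rw [Real.dist_eq, Real.dist_eq, add_sub_cancel_left] at h1
    exact (le_abs_self _).trans h1

lemma Regular.continuous_bellman (hu : Regular u K) (hF : Integrable (fun z : ℝ => z) F)
    (w : ℝ →ᵇ ℝ) : Continuous (Function.uncurry (bellman n u lam F w)) := by
  have h1 : Continuous fun p : ℝ × ℝ => expAfter F (u 0) p.1 :=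
    (hu.continuous_expAfter_benefit hF).comp continuous_fst
  have h2 : Continuous fun p : ℝ × ℝ => expAfter F w p.1 :=
    (continuous_expAfter_bounded w).comp continuous_fst
  have h3 : Continuous fun p : ℝ × ℝ => u 0 p.1 := hu.lip.continuous.comp continuous_fst
  have h4 : Continuous fun p : ℝ × ℝ => u p.2 p.1 :=
    hu.cont.comp (continuous_snd.prodMk continuous_fst)
  have h5 : Continuous fun p : ℝ × ℝ => w p.1 := w.continuous.comp continuous_fst
  have h6 : Continuous fun p : ℝ × ℝ => p.2 := continuous_snd
  exact (((((h6.mul_const lam).mul_const (n : ℝ)).mul (h1.sub h3)).sub (h3.sub h4)).add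
    (((h6.mul h2).add ((continuous_const.sub h6).mul h5)).const_mul (lam * n))).div_const _

lemma bellman_le_add (hl : 0 < lam) (w w' : ℝ →ᵇ ℝ) {a : ℝ} (ha : a ∈ Icc (0 : ℝ) 1) (x : ℝ) :
    bellman n u lam F w x a
      ≤ bellman n u lam F w' x a + lam * n / (1 + lam * n) * dist w w' := by
  have h1 := expAfter_le_add (F := F) w w' x
  have h2 : w x ≤ w' x + dist w w' := by
    have := (abs_le.1 ((Real.dist_eq _ _).symm.le.trans (w.dist_coe_le_dist (g := w') x))).2
    linarith
  have hln : 0 ≤ lam * n := by positivity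
  have h3 : a * expAfter F w x + (1 - a) * w x
      ≤ a * expAfter F w' x + (1 - a) * w' x + dist w w' := by
    nlinarith [mul_le_mul_of_nonneg_left h1 ha.1,
      mul_le_mul_of_nonneg_left h2 (sub_nonneg.2 ha.2)]
  rw [bellman, bellman, div_mul_eq_mul_div, ← add_div]
  refine div_le_div_of_nonneg_right ?_ (by positivity)
  nlinarith [mul_le_mul_of_nonneg_left h3 hln]

/-- Banach's fixed point theorem yields a bounded continuous `w` such that `u 0 + w` solves the
Hamilton-Jacobi-Bellman equation. -/
theorem Regular.exists_fixedPoint (hu : Regular u K) (hF : Integrable (fun z : ℝ => z) F)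
    (hpos : ∀ᵐ z ∂F, 0 < z) (hl : 0 < lam) (n : ℕ) :
    ∃ w : ℝ →ᵇ ℝ, ∀ x, w x = maxUpTo (bellman n u lam F w) 1 x := by
  have hln : 0 ≤ lam * n := by positivity
  have h1ln : 0 < 1 + lam * n := by positivity
  set B := lam * n * (K * ∫ z, |z| ∂F) with hB
  have hB0 : 0 ≤ B := by
    have : 0 ≤ ∫ z, |z| ∂F := integral_nonneg fun z => abs_nonneg z
    positivity
  have hbound : ∀ (w : ℝ →ᵇ ℝ) (x : ℝ),
      ‖maxUpTo (bellman n u lam F w) 1 x‖ ≤ B + lam * n * ‖w‖ := by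
    intro w x
    have hc := hu.continuous_bellman (n := n) (lam := lam) hF w
    have hwx : |w x| ≤ ‖w‖ := w.norm_coe_le_norm x
    have hEx := abs_expAfter_le (F := F) w x
    have hR : 0 ≤ B + lam * n * ‖w‖ := by positivity
    rw [Real.norm_eq_abs, abs_le]
    constructor
    · refine le_trans ?_ (le_maxUpTo hc (left_mem_Icc.2 zero_le_one))
      have h0 : bellman n u lam F w x 0 = lam * n * w x / (1 + lam * n) := by
        simp [bellman]
      rw [h0, le_div_iff₀ h1ln]
      nlinarith [mul_le_mul_of_nonneg_left (abs_le.1 hwx).1 hln]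
    · obtain ⟨a, ha, he⟩ := exists_maxUpTo_eq hc zero_le_one x
      rw [he, bellman, div_le_iff₀ h1ln]
      have hβ := hu.expAfter_benefit_sub_mem hF hpos x
      have h1 : a * lam * n * (expAfter F (u 0) x - u 0 x) ≤ B := by
        rw [mul_assoc a, hB]
        calc a * (lam * n) * _ ≤ 1 * (lam * n) * (K * ∫ z, |z| ∂F) := by
              gcongr
              · exact hβ.1
              · exact ha.2
              · exact hβ.2
          _ = _ := by ring
      have h2 := hu.cost_nonneg a ha x
      have h3 : a * expAfter F w x + (1 - a) * w x ≤ ‖w‖ := by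
        nlinarith [mul_le_mul_of_nonneg_left (abs_le.1 hEx).2 ha.1,
          mul_le_mul_of_nonneg_left (abs_le.1 hwx).2 (sub_nonneg.2 ha.2)]
      nlinarith [mul_le_mul_of_nonneg_left h3 hln, mul_nonneg hR hln]
  set Tw : (ℝ →ᵇ ℝ) → (ℝ →ᵇ ℝ) := fun w =>
    BoundedContinuousFunction.ofNormedAddCommGroup (maxUpTo (bellman n u lam F w) 1)
      (continuous_maxUpTo (hu.continuous_bellman hF w) 1) _ (hbound w) with hTw
  set κ : NNReal := ⟨lam * n / (1 + lam * n), by positivity⟩ with hκ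
  have hle : ∀ (w w' : ℝ →ᵇ ℝ) x, Tw w x ≤ Tw w' x + κ * dist w w' := by
    intro w w' x
    obtain ⟨a, ha, he⟩ := exists_maxUpTo_eq
      (hu.continuous_bellman (n := n) (lam := lam) hF w) zero_le_one x
    calc Tw w x = bellman n u lam F w x a := he
      _ ≤ bellman n u lam F w' x a + κ * dist w w' := bellman_le_add hl w w' ha x
      _ ≤ Tw w' x + κ * dist w w' := by
        gcongr
        exact le_maxUpTo (hu.continuous_bellman hF w') ha
  have hcontr : ContractingWith κ Tw := by
    refine ⟨?_, LipschitzWith.of_dist_le_mul fun w w' => ?_⟩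
    · rw [← NNReal.coe_lt_coe]
      exact (div_lt_one h1ln).2 (by simp)
    · rw [BoundedContinuousFunction.dist_le (by positivity)]
      intro x
      rw [Real.dist_eq, abs_le]
      have h1 := hle w w' x
      have h2 := hle w' w x
      rw [dist_comm] at h2
      constructor <;> linarith
  refine ⟨ContractingWith.fixedPoint Tw hcontr, fun x => ?_⟩
  have hfix : Tw _ = _ := hcontr.fixedPoint_isFixedPt
  conv_lhs => rw [← hfix]
  rfl

/-- `v` solves the Hamilton-Jacobi-Bellman equation
`v x = max_a {u a x + a lam n (E v(x + z) - v x)}` and exceeds the value `u 0` of no effort by a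
bounded amount. -/
structure HJBSolution (n : ℕ) (u : ℝ → ℝ → ℝ) (lam : ℝ) (F : Measure ℝ) (v : ℝ → ℝ) : Prop where
  cont : Continuous v
  cont_expAfter : Continuous (expAfter F v)
  integrable : ∀ x, Integrable (fun z => v (x + z)) F
  le : ∀ x, u 0 x ≤ v x
  bounded : ∃ B, ∀ x, v x ≤ u 0 x + B
  super : ∀ x, ∀ a ∈ Icc (0 : ℝ) 1, u a x + a * lam * n * (expAfter F v x - v x) ≤ v x
  attained : ∀ x, ∃ a ∈ Icc (0 : ℝ) 1, u a x + a * lam * n * (expAfter F v x - v x) = v x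

theorem Regular.exists_solution (hu : Regular u K) (hF : Integrable (fun z : ℝ => z) F)
    (hpos : ∀ᵐ z ∂F, 0 < z) (hl : 0 < lam) (n : ℕ) : ∃ v, HJBSolution n u lam F v := by
  obtain ⟨w, hw⟩ := hu.exists_fixedPoint hF hpos hl n
  have h1ln : 0 < 1 + lam * n := by positivity
  have hc := hu.continuous_bellman (n := n) (lam := lam) hF w
  have hexp : ∀ x, expAfter F (fun y => u 0 y + w y) x = expAfter F (u 0) x + expAfter F w x :=
    fun x => integral_add (hu.integrable_benefit hF x) (integrable_shift_bounded w x)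
  have hw0 : ∀ x, 0 ≤ w x := by
    intro x
    have h0 : bellman n u lam F w x 0 ≤ w x := by
      conv_rhs => rw [hw x]
      exact le_maxUpTo hc (left_mem_Icc.2 zero_le_one)
    have h1 : bellman n u lam F w x 0 = lam * n * w x / (1 + lam * n) := by
      simp [bellman]
    rw [h1, div_le_iff₀ h1ln] at h0
    linarith
  refine ⟨fun y => u 0 y + w y, hu.lip.continuous.add w.continuous, ?_,
    fun x => (hu.integrable_benefit hF x).add (integrable_shift_bounded w x),
    fun x => le_add_of_nonneg_right (hw0 x),
    ⟨‖w‖, fun x => by gcongr; exact (le_abs_self _).trans (w.norm_coe_le_norm x)⟩, ?_, ?_⟩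
  · rw [funext hexp]
    exact (hu.continuous_expAfter_benefit hF).add (continuous_expAfter_bounded w)
  · intro x a ha
    have h0 : bellman n u lam F w x a ≤ w x := by
      conv_rhs => rw [hw x]
      exact le_maxUpTo hc ha
    rw [bellman, div_le_iff₀ h1ln] at h0
    rw [hexp]
    linarith
  · intro x
    obtain ⟨a, ha, he⟩ := exists_maxUpTo_eq hc zero_le_one x
    refine ⟨a, ha, ?_⟩
    rw [← hw x, bellman, eq_div_iff h1ln.ne'] at he
    rw [hexp]
    linarith

/-- Where effort is not worthwhile even if no effort follows, now or at any higher stock, the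
solution is the value of no effort. -/
lemma HJBSolution.eq_benefit {v : ℝ → ℝ} (hv : HJBSolution n u lam F v) (hu : Regular u K)
    (hF : Integrable (fun z : ℝ => z) F) (hpos : ∀ᵐ z ∂F, 0 < z) (hl : 0 < lam) {xs : ℝ}
    (hxs : ∀ x, xs ≤ x → ∀ a ∈ Icc (0 : ℝ) 1,
      a * lam * n * (expAfter F (u 0) x - u 0 x) ≤ u 0 x - u a x) {x : ℝ} (hx : xs ≤ x) :
    v x = u 0 x := by
  have h1ln : 0 < 1 + lam * n := by positivity
  have hln : 0 ≤ lam * n := by positivity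
  obtain ⟨B, hB⟩ := hv.bounded
  set D : Set ℝ := (fun y => v y - u 0 y) '' Ici xs with hD
  have hbdd : BddAbove D := by
    refine ⟨B, ?_⟩
    rintro _ ⟨y, _, rfl⟩
    linarith [hB y]
  set S := sSup D with hS
  have hleS : ∀ y, xs ≤ y → v y - u 0 y ≤ S := fun y hy =>
    le_csSup hbdd ⟨y, hy, rfl⟩
  have hstep : ∀ y, xs ≤ y → (1 + lam * n) * (v y - u 0 y) ≤ lam * n * S := by
    intro y hy
    obtain ⟨a, ha, he⟩ := hv.attained y
    have hE : expAfter F v y ≤ expAfter F (u 0) y + S := by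
      have h1 : expAfter F v y ≤ ∫ z, (u 0 (y + z) + S) ∂F := by
        refine integral_mono_ae (hv.integrable y)
          ((hu.integrable_benefit hF y).add (integrable_const _)) ?_
        filter_upwards [hpos] with z hz
        have := hleS (y + z) (by linarith)
        linarith
      rw [integral_add (hu.integrable_benefit hF y) (integrable_const _)] at h1
      simpa [expAfter] using h1
    have h2 := hxs y hy a ha
    have h3 := hleS y hy
    have h4 : v y - u 0 y ≤ a * (lam * n) * (S - (v y - u 0 y)) := by
      have h5 : a * (lam * n) * (expAfter F v y - v y)
          ≤ a * (lam * n) * (expAfter F (u 0) y + S - v y) :=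
        mul_le_mul_of_nonneg_left (by linarith) (mul_nonneg ha.1 hln)
      nlinarith
    -- The bound `S` exceeds `v y - u 0 y`, so effort may be replaced by its upper bound.
    have h6 : a * (lam * n) * (S - (v y - u 0 y)) ≤ 1 * (lam * n) * (S - (v y - u 0 y)) :=
      mul_le_mul_of_nonneg_right (mul_le_mul_of_nonneg_right ha.2 hln) (by linarith)
    linarith
  have hS0 : (1 + lam * n) * S ≤ lam * n * S := by
    have : S ≤ lam * n * S / (1 + lam * n) := by
      refine csSup_le ⟨_, xs, self_mem_Ici, rfl⟩ ?_
      rintro _ ⟨y, hy, rfl⟩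
      rw [le_div_iff₀ h1ln, mul_comm]
      exact hstep y hy
    rwa [le_div_iff₀ h1ln, mul_comm] at this
  linarith [hleS x hx, hv.le x]

end HJB

/-! ### Consequences of the standing assumptions -/

/-- The extension of the flow payoff from `[0,1] × [0,∞)` to the plane that is constant beyond the
boundary. -/
noncomputable def extendFlow (u : ℝ → ℝ → ℝ) (a x : ℝ) : ℝ := u (max 0 (min a 1)) (max x 0)

lemma extendFlow_eq (u : ℝ → ℝ → ℝ) {a x : ℝ} (ha : a ∈ Icc (0 : ℝ) 1) (hx : 0 ≤ x) :
    extendFlow u a x = u a x := by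
  rw [extendFlow, min_eq_left ha.2, max_eq_right ha.1, max_eq_left hx]

lemma extendFlow_of_mem (u : ℝ → ℝ → ℝ) {a : ℝ} (ha : a ∈ Icc (0 : ℝ) 1) (x : ℝ) :
    extendFlow u a x = u a (max x 0) := by
  rw [extendFlow, min_eq_left ha.2, max_eq_right ha.1]

section Primitives

variable {n : ℕ} {u : ℝ → ℝ → ℝ} {lam : ℝ} {F : Measure ℝ}

lemma zero_mem_unit : (0 : ℝ) ∈ Icc (0 : ℝ) 1 := left_mem_Icc.2 zero_le_one

lemma one_mem_unit : (1 : ℝ) ∈ Icc (0 : ℝ) 1 := right_mem_Icc.2 zero_le_one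

lemma cost_zero (u : ℝ → ℝ → ℝ) (x : ℝ) : cost u 0 x = 0 := sub_self _

namespace StandingAssumptions

lemma ae_pos (hyp : StandingAssumptions n u lam F) : ∀ᵐ z ∂F, 0 < z := by
  rw [ae_iff]
  have : {z : ℝ | ¬0 < z} = Iic 0 := by
    ext z
    simp
  rw [this]
  exact hyp.size_pos

lemma cost_nonneg (hyp : StandingAssumptions n u lam F) {a x : ℝ} (ha : a ∈ Icc (0 : ℝ) 1)
    (hx : 0 ≤ x) : 0 ≤ cost u a x := by
  have := hyp.cost_mono x hx zero_mem_unit ha ha.1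
  simpa [cost_zero] using this

lemma hasDerivWithinAt_benefit (hyp : StandingAssumptions n u lam F) :
    ∃ D, HasDerivWithinAt (u 0) D (Ici 0) 0 := by
  have h1 : ContDiffOn ℝ 2 (fun x : ℝ => u 0 x) (Ici 0) :=
    hyp.u_contDiff.comp (contDiff_const.prodMk contDiff_id).contDiffOn
      fun x hx => ⟨zero_mem_unit, hx⟩
  exact ⟨_, ((h1.differentiableOn (by norm_num)) 0 self_mem_Ici).hasDerivWithinAt⟩

lemma hasDerivWithinAt_cost (hyp : StandingAssumptions n u lam F) {x : ℝ} (hx : 0 ≤ x) :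
    HasDerivWithinAt (fun a => cost u a x) (cost₁ u 0 x) (Icc 0 1) 0 := by
  have h1 : ContDiffOn ℝ 2 (fun a : ℝ => u a x) (Icc 0 1) :=
    hyp.u_contDiff.comp (contDiff_id.prodMk contDiff_const).contDiffOn
      fun a ha => ⟨ha, hx⟩
  have h2 : DifferentiableOn ℝ (fun a : ℝ => cost u a x) (Icc 0 1) :=
    (differentiableOn_const _).sub (h1.differentiableOn (by norm_num))
  exact (h2 0 zero_mem_unit).hasDerivWithinAt

/-- Concavity and differentiability at the origin make benefits Lipschitz. -/
lemma exists_benefit_sub_le (hyp : StandingAssumptions n u lam F) :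
    ∃ K : NNReal, ∀ x y, 0 ≤ x → x ≤ y → u 0 y - u 0 x ≤ K * (y - x) := by
  obtain ⟨D, hD⟩ := hyp.hasDerivWithinAt_benefit
  have hconc := hyp.u_concave 0 zero_mem_unit
  have h0 : ∀ y, 0 < y → (u 0 y - u 0 0) / (y - 0) ≤ D := by
    intro y hy
    have := hconc.slope_le_of_hasDerivWithinAt self_mem_Ici (mem_Ici.2 hy.le) hy hD
    rwa [slope_def_field] at this
  refine ⟨D.toNNReal, fun x y hx hxy => ?_⟩
  rcases hxy.eq_or_lt with rfl | hlt
  · simp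
  have hs : (u 0 y - u 0 x) / (y - x) ≤ D := by
    rcases hx.eq_or_lt with rfl | hx0
    · exact h0 y hlt
    · exact (hconc.slope_anti_adjacent self_mem_Ici (mem_Ici.2 (hx.trans hxy)) hx0 hlt).trans
        (h0 x hx0)
  rw [div_le_iff₀ (sub_pos.2 hlt)] at hs
  exact hs.trans (mul_le_mul_of_nonneg_right (Real.le_coe_toNNReal D) (sub_nonneg.2 hxy))

lemma exists_regular (hyp : StandingAssumptions n u lam F) :
    ∃ K, Regular (extendFlow u) K := by
  obtain ⟨K, hK⟩ := hyp.exists_benefit_sub_le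
  have hmono : Monotone (extendFlow u 0) := by
    intro x y hxy
    rw [extendFlow_of_mem u zero_mem_unit, extendFlow_of_mem u zero_mem_unit]
    exact hyp.u_mono 0 zero_mem_unit (mem_Ici.2 (le_max_right _ _)) (mem_Ici.2 (le_max_right _ _))
      (max_le_max_right 0 hxy)
  refine ⟨K, ⟨?_, ?_, hmono, ?_⟩⟩
  · have hφ : Continuous fun p : ℝ × ℝ => ((max 0 (min p.1 1), max p.2 0) : ℝ × ℝ) := by fun_prop
    exact hyp.u_contDiff.continuousOn.comp_continuous hφ fun p =>
      ⟨⟨le_max_left _ _, max_le zero_le_one (min_le_right _ _)⟩, mem_Ici.2 (le_max_right _ _)⟩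
  · have hle : ∀ x y, x ≤ y → |extendFlow u 0 x - extendFlow u 0 y| ≤ K * |x - y| := by
      intro x y hxy
      rw [abs_sub_comm, abs_of_nonneg (sub_nonneg.2 (hmono hxy)),
        extendFlow_of_mem u zero_mem_unit, extendFlow_of_mem u zero_mem_unit, abs_sub_comm x,
        abs_of_nonneg (sub_nonneg.2 hxy)]
      refine (hK _ _ (le_max_right _ _) (max_le_max_right 0 hxy)).trans
        (mul_le_mul_of_nonneg_left ?_ K.2)
      rcases le_total x 0 with h1 | h1 <;> rcases le_total y 0 with h2 | h2 <;>
        simp [h1, h2] <;> linarith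
    refine LipschitzWith.of_dist_le_mul fun x y => ?_
    rw [Real.dist_eq, Real.dist_eq]
    rcases le_total x y with hxy | hxy
    · exact hle x y hxy
    · rw [abs_sub_comm, abs_sub_comm x]
      exact hle y x hxy
  · intro a ha x
    rw [extendFlow_of_mem u ha, extendFlow_of_mem u zero_mem_unit]
    exact sub_nonneg.1 (hyp.cost_nonneg ha (le_max_right x 0))

lemma abs_extendFlow_le (hyp : StandingAssumptions n u lam F) {K : NNReal}
    (hu : Regular (extendFlow u) K) {a : ℝ} (ha : a ∈ Icc (0 : ℝ) 1) (x : ℝ) :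
    |extendFlow u a x| ≤ (|u 1 0| + |u 0 0| + K) * (1 + |x|) := by
  have h1 := hu.cost_nonneg a ha x
  have h2 := hu.lip.dist_le_mul x 0
  rw [Real.dist_eq, Real.dist_eq, sub_zero, extendFlow_eq u zero_mem_unit le_rfl] at h2
  have h3 := (abs_le.1 h2).2
  have h4 : u 1 0 ≤ u a 0 := by
    have := hyp.cost_mono 0 le_rfl ha one_mem_unit ha.2
    simp only [cost] at this
    linarith
  have h5 : u a 0 ≤ extendFlow u a x := by
    rw [extendFlow_of_mem u ha]
    exact hyp.u_mono a ha self_mem_Ici (mem_Ici.2 (le_max_right _ _)) (le_max_right _ _)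
  have h6 := neg_abs_le (u 1 0)
  have h7 := le_abs_self (u 0 0)
  have h8 := abs_nonneg (u 1 0)
  have h9 := abs_nonneg (u 0 0)
  have h10 := abs_nonneg x
  have h11 : 0 ≤ (K : ℝ) := K.2
  have h12 : 0 ≤ (|u 1 0| + |u 0 0|) * |x| := by positivity
  have h13 : 0 ≤ K * |x| := by positivity
  rw [abs_le]
  constructor <;> nlinarith

/-! ### The marginal social value of effort -/

/-- By convexity, the marginal cost at zero effort exceeds `s` if and only if no effort level has
average cost below `s`. -/
lemma le_cost₁_iff (hyp : StandingAssumptions n u lam F) {x : ℝ} (hx : 0 ≤ x) (s : ℝ) :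
    s ≤ cost₁ u 0 x ↔ ∀ a ∈ Icc (0 : ℝ) 1, a * s ≤ cost u a x := by
  have hd := hyp.hasDerivWithinAt_cost hx
  constructor
  · intro h a ha
    rcases ha.1.eq_or_lt with rfl | hpos
    · simp [cost_zero]
    · have h1 := (hyp.cost_convex x hx).le_slope_of_hasDerivWithinAt zero_mem_unit ha hpos hd
      rw [slope_def_field, cost_zero, sub_zero, sub_zero, le_div_iff₀ hpos] at h1
      nlinarith
  · intro h
    have hd' : HasDerivWithinAt (fun a => cost u a x) (cost₁ u 0 x) (Ioc 0 1) 0 :=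
      hd.mono Ioc_subset_Icc_self
    rw [hasDerivWithinAt_iff_tendsto_slope' (by simp)] at hd'
    have : (𝓝[Ioc (0 : ℝ) 1] 0).NeBot := by
      rw [nhdsWithin_Ioc_eq_nhdsGT zero_lt_one]
      infer_instance
    refine ge_of_tendsto hd' ?_
    filter_upwards [self_mem_nhdsWithin] with a ha
    rw [slope_def_field, cost_zero, sub_zero, sub_zero, le_div_iff₀ ha.1, mul_comm]
    exact h a ⟨ha.1.le, ha.2⟩

lemma expAfter_extendFlow (hyp : StandingAssumptions n u lam F) {x : ℝ} (hx : 0 ≤ x) :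
    expAfter F (benefit u) x = expAfter F (extendFlow u 0) x := by
  refine integral_congr_ae ?_
  filter_upwards [hyp.ae_pos] with z hz
  exact (extendFlow_eq u zero_mem_unit (by linarith)).symm

lemma socialValue_eq (hyp : StandingAssumptions n u lam F) {x : ℝ} (hx : 0 ≤ x) :
    socialValue n u lam F x
      = lam * n * (expAfter F (extendFlow u 0) x - extendFlow u 0 x) := by
  rw [socialValue, hyp.expAfter_extendFlow hx, extendFlow_eq u zero_mem_unit hx, benefit]

variable [IsProbabilityMeasure F]

/-- Concave benefits make the marginal social value of effort nonincreasing in the stock. -/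
lemma socialValue_anti (hyp : StandingAssumptions n u lam F) {x y : ℝ} (hx : 0 ≤ x)
    (hxy : x ≤ y) : socialValue n u lam F y ≤ socialValue n u lam F x := by
  obtain ⟨K, hu⟩ := hyp.exists_regular
  have hi := fun x => hu.integrable_benefit hyp.size_integrable x
  have hconc := hyp.u_concave 0 zero_mem_unit
  have hkey : ∀ z, 0 < z → u 0 (y + z) - u 0 y ≤ u 0 (x + z) - u 0 x := by
    intro z hz
    rcases hxy.eq_or_lt with rfl | hlt
    · exact le_rfl
    have hd : 0 < y - x + z := by linarith
    have ht0 : 0 ≤ (y - x) / (y - x + z) := div_nonneg (by linarith) hd.le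
    have ht1 : 0 ≤ z / (y - x + z) := div_nonneg hz.le hd.le
    have hsum : z / (y - x + z) + (y - x) / (y - x + z) = 1 := by
      field_simp
      ring
    -- `y` and `x + z` are convex combinations of `x` and `y + z`, with exchanged weights.
    have hX : x ∈ Ici (0 : ℝ) := hx
    have hY : y + z ∈ Ici (0 : ℝ) := mem_Ici.2 (by linarith)
    have h1 := hconc.2 hX hY ht1 ht0 hsum
    have h2 := hconc.2 hX hY ht0 ht1 (by rw [add_comm]; exact hsum)
    simp only [smul_eq_mul] at h1 h2
    have e1 : z / (y - x + z) * x + (y - x) / (y - x + z) * (y + z) = y := by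
      field_simp
      ring
    have e2 : (y - x) / (y - x + z) * x + z / (y - x + z) * (y + z) = x + z := by
      field_simp
      ring
    rw [e1] at h1
    rw [e2] at h2
    have e3 : u 0 x + u 0 (y + z)
        = z / (y - x + z) * u 0 x + (y - x) / (y - x + z) * u 0 (y + z)
          + ((y - x) / (y - x + z) * u 0 x + z / (y - x + z) * u 0 (y + z)) := by
      linear_combination (-(u 0 x + u 0 (y + z))) * hsum
    linarith
  have hy : 0 ≤ y := hx.trans hxy
  rw [hyp.socialValue_eq hx, hyp.socialValue_eq hy]
  have hln : 0 ≤ lam * n := mul_nonneg hyp.lam_pos.le (Nat.cast_nonneg n)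
  refine mul_le_mul_of_nonneg_left ?_ hln
  have hrw : ∀ x, expAfter F (extendFlow u 0) x - extendFlow u 0 x
      = ∫ z, (extendFlow u 0 (x + z) - extendFlow u 0 x) ∂F := by
    intro x
    rw [integral_sub (hi x) (integrable_const _)]
    simp [expAfter]
  rw [hrw, hrw]
  refine integral_mono_ae ((hi y).sub (integrable_const _)) ((hi x).sub (integrable_const _)) ?_
  filter_upwards [hyp.ae_pos] with z hz
  rw [extendFlow_eq u zero_mem_unit hx, extendFlow_eq u zero_mem_unit hy,
    extendFlow_eq u zero_mem_unit (by linarith : 0 ≤ x + z),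
    extendFlow_eq u zero_mem_unit (by linarith : 0 ≤ y + z)]
  exact hkey z hz

lemma socialValue_le_cost₁_of_le (hyp : StandingAssumptions n u lam F) {x y : ℝ} (hx : 0 ≤ x)
    (hxy : x ≤ y) (h : socialValue n u lam F x ≤ cost₁ u 0 x) :
    socialValue n u lam F y ≤ cost₁ u 0 y :=
  (hyp.socialValue_anti hx hxy).trans
    (h.trans (hyp.cost₁_mono 0 zero_mem_unit hx (hx.trans hxy) hxy))

lemma isClosed_socialValue_le (hyp : StandingAssumptions n u lam F) :
    IsClosed {x : ℝ | 0 ≤ x ∧ socialValue n u lam F x ≤ cost₁ u 0 x} := by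
  obtain ⟨K, hu⟩ := hyp.exists_regular
  have hset : {x : ℝ | 0 ≤ x ∧ socialValue n u lam F x ≤ cost₁ u 0 x}
      = Ici 0 ∩ ⋂ a ∈ Icc (0 : ℝ) 1,
        {x | a * (lam * n * (expAfter F (extendFlow u 0) x - extendFlow u 0 x))
          ≤ extendFlow u 0 x - extendFlow u a x} := by
    ext x
    simp only [mem_inter_iff, mem_Ici, mem_iInter, mem_ofPred_eq]
    refine and_congr_right fun hx => ?_
    rw [hyp.le_cost₁_iff hx, hyp.socialValue_eq hx]
    refine forall₂_congr fun a ha => ?_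
    rw [cost, extendFlow_eq u zero_mem_unit hx, extendFlow_eq u ha hx]
  rw [hset]
  refine isClosed_Ici.inter (isClosed_biInter fun a _ => isClosed_le ?_ ?_)
  · exact continuous_const.mul (continuous_const.mul
      ((hu.continuous_expAfter_benefit hyp.size_integrable).sub hu.lip.continuous))
  · exact hu.lip.continuous.sub (hu.cont.comp (Continuous.prodMk_right a))

end StandingAssumptions

end Primitives

/-! ### Sample paths of the stock -/

section SamplePaths

variable {n : ℕ} {lam : ℝ} {F : Measure ℝ}

lemma ae_forall_size [IsProbabilityMeasure F] (n : ℕ) {p : ℝ → Prop} (hp : ∀ᵐ z ∂F, p z) :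
    ∀ᵐ ω ∂(noiseLaw n F), ∀ m, p (ω m).2 := by
  rw [ae_all_iff]
  intro m
  have h1 : MeasurePreserving (fun ω : Noise n => (ω m).2) (noiseLaw n F) F :=
    measurePreserving_snd.comp (measurePreserving_eval_infinitePi (fun _ => stepLaw n F) m)
  exact h1.quasiMeasurePreserving.ae hp

/-- By the strong law of large numbers, the sizes of the innovations add up to infinity. -/
lemma ae_tendsto_sum_size [IsProbabilityMeasure F] (n : ℕ) (hF : Integrable (fun z : ℝ => z) F)
    (hpos : ∀ᵐ z ∂F, 0 < z) :
    ∀ᵐ ω ∂(noiseLaw n F), Tendsto (fun M => ∑ j ∈ Finset.range M, (ω j).2) atTop atTop := by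
  have hmp : ∀ m, MeasurePreserving (fun ω : Noise n => (ω m).2) (noiseLaw n F) F := fun m =>
    measurePreserving_snd.comp (measurePreserving_eval_infinitePi (fun _ => stepLaw n F) m)
  have hindep : iIndepFun (fun m (ω : Noise n) => (ω m).2) (noiseLaw n F) :=
    iIndepFun_infinitePi (P := fun _ : ℕ => stepLaw n F) (X := fun _ y => y.2)
      fun _ => measurable_snd
  have hslln := strong_law_ae_real (μ := noiseLaw n F) (fun m (ω : Noise n) => (ω m).2)
    ((hmp 0).integrable_comp_of_integrable hF) (fun i j hij => hindep.indepFun hij)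
    (fun m => ⟨(hmp m).aemeasurable, (hmp 0).aemeasurable, by rw [(hmp m).map_eq, (hmp 0).map_eq]⟩)
  have hmean : ∫ ω : Noise n, (ω 0).2 ∂(noiseLaw n F) = ∫ z, z ∂F := by
    conv_rhs => rw [← (hmp 0).map_eq]
    exact (integral_map (hmp 0).aemeasurable aestronglyMeasurable_id).symm
  have hμ : 0 < ∫ z, z ∂F := by
    rw [integral_pos_iff_support_of_nonneg_ae (hpos.mono fun z hz => hz.le) hF]
    have : Function.support (fun z : ℝ => z) =ᵐ[F] univ :=
      eventuallyEq_univ.2 (hpos.mono fun z hz => ne_of_gt hz)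
    rw [measure_congr this, measure_univ]
    exact one_pos
  filter_upwards [hslln] with ω hω
  rw [hmean] at hω
  have h1 := hω.pos_mul_atTop hμ (tendsto_natCast_atTop_atTop (R := ℝ))
  refine h1.congr' ?_
  filter_upwards [eventually_gt_atTop 0] with M hM
  have : (M : ℝ) ≠ 0 := Nat.cast_ne_zero.2 hM.ne'
  field_simp

/-- The stock upon the `m`-th innovation, if there is one (see `stock_of_path`): the initial stock
plus the first `m` sizes. -/
def stockSeq (x₀ : ℝ) (ω : Noise n) (m : ℕ) : ℝ := x₀ + ∑ j ∈ Finset.range m, (ω j).2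

/-- The innovations do not accumulate in finite time along the path `ω`. -/
def NonExplosive (lam : ℝ) (σ : Fin n → Strategy n) (x₀ : ℝ) (ω : Noise n) : Prop :=
  ∀ t : ℝ, ∃ M, ∀ m ≥ M, ∀ h, path lam σ x₀ ω m = some h → t < h.time

/-- The discount factors at the innovations have finite expected sum. -/
lemma ae_nonExplosive [IsProbabilityMeasure F] [NeZero n] (hF : Integrable (fun z : ℝ => z) F)
    (hl : 0 < lam) (σ : Fin n → Strategy n) (x₀ : ℝ) :
    ∀ᵐ ω ∂(noiseLaw n F), NonExplosive lam σ x₀ ω := by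
  set D : ℕ → Noise n → ℝ := fun m => discounted lam σ x₀ (weight n lam F) m with hD
  have hD0 : ∀ m ω, 0 ≤ D m ω := fun m ω => discounted_weight_nonneg hl σ x₀ m ω
  have hDm : ∀ m, Measurable (D m) := fun m =>
    measurable_discounted hl σ x₀ (valueBound_weight n hl).meas m
  have hs : Summable fun m => decay n lam ^ m * weight n lam F x₀ :=
    (summable_geometric_of_lt_one (decay_nonneg n hl) (decay_lt_one n hl)).mul_right _
  have hfin : ∫⁻ ω, ∑' m, ENNReal.ofReal (D m ω) ∂(noiseLaw n F) ≠ ⊤ := by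
    rw [lintegral_tsum fun m => (hDm m).ennreal_ofReal.aemeasurable]
    refine ne_top_of_le_ne_top hs.tsum_ofReal_ne_top (ENNReal.tsum_le_tsum fun m => ?_)
    have hw := integrable_discounted_weight hF hl σ x₀ m
    rw [← ofReal_integral_eq_lintegral_ofReal hw.1 (Eventually.of_forall (hD0 m))]
    exact ENNReal.ofReal_le_ofReal hw.2
  have hmeas : Measurable fun ω => ∑' m, ENNReal.ofReal (D m ω) :=
    Measurable.tsum fun m => (hDm m).ennreal_ofReal
  filter_upwards [ae_lt_top hmeas hfin] with ω hω t
  have h0 := ENNReal.tendsto_atTop_zero_of_tsum_ne_top hω.ne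
  have hev := h0.eventually_lt_const (ENNReal.ofReal_pos.2 (Real.exp_pos (-t)))
  obtain ⟨M, hM⟩ := eventually_atTop.1 hev
  refine ⟨M, fun m hm h hh => ?_⟩
  have h1 := (ENNReal.ofReal_lt_ofReal_iff (Real.exp_pos _)).1 (hM m hm)
  simp only [hD, discounted, hh, Option.elim_some] at h1
  have h2 : Real.exp (-h.time) * 1 ≤ Real.exp (-h.time) * weight n lam F h.stock :=
    mul_le_mul_of_nonneg_left
      (le_trans (by linarith [abs_nonneg h.stock]) (one_add_abs_le_weight n hl _))
      (Real.exp_nonneg _)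
  rw [mul_one] at h2
  have h3 := Real.exp_lt_exp.1 (h2.trans_lt h1)
  linarith

section Deterministic

variable {σ : Fin n → Strategy n} {x₀ : ℝ} {ω : Noise n}

/-- The contribution of the `(m + 1)`-st innovation to the stock at time `t`. -/
noncomputable def increment (lam : ℝ) (σ : Fin n → Strategy n) (x₀ : ℝ) (ω : Noise n) (t : ℝ)
    (m : ℕ) : ℝ :=
  (path lam σ x₀ ω (m + 1)).elim 0 (fun h => if h.time ≤ t then (h.2 (Fin.last m)).2.1 else 0)

lemma increment_eq_zero {t : ℝ} {m : ℕ}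
    (hm : ∀ h, path lam σ x₀ ω (m + 1) = some h → t < h.time) :
    increment lam σ x₀ ω t m = 0 := by
  rw [increment]
  cases hh : path lam σ x₀ ω (m + 1) with
  | none => rfl
  | some h => exact if_neg (not_le.2 (hm h hh))

variable [NeZero n]

lemma path_succ_eq_some {m : ℕ} {h' : Hist n (m + 1)} (hh : path lam σ x₀ ω (m + 1) = some h') :
    ∃ h, path lam σ x₀ ω m = some h ∧ nextTime lam σ h (ω m).1 ≠ ⊤ ∧
      h' = succHist lam σ h (ω m).1 (ω m).2 := by
  rw [path] at hh
  obtain ⟨h, h1, h2⟩ := Option.bind_eq_some_iff.1 hh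
  by_cases ht : nextTime lam σ h (ω m).1 = ⊤
  · simp [nextHist_eq_none ht] at h2
  · rw [nextHist_eq_some ht, Option.some_inj] at h2
    exact ⟨h, h1, ht, h2.symm⟩

lemma time_le_time_succHist {m : ℕ} {h : Hist n m} {e : Fin n → ℝ}
    (ht : nextTime lam σ h e ≠ ⊤) (z : ℝ) : h.time ≤ (succHist lam σ h e z).time := by
  rw [time_succHist]
  simpa using EReal.toReal_le_toReal (le_nextTime lam σ h e) (EReal.coe_ne_bot _) ht

lemma exists_path_of_le {k m : ℕ} (hkm : k ≤ m) {h : Hist n m}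
    (hh : path lam σ x₀ ω m = some h) :
    ∃ h' : Hist n k, path lam σ x₀ ω k = some h' ∧ h'.time ≤ h.time := by
  induction m, hkm using Nat.le_induction with
  | base => exact ⟨h, hh, le_rfl⟩
  | succ m _ ih =>
    obtain ⟨h1, hp, ht, rfl⟩ := path_succ_eq_some hh
    obtain ⟨h', hp', hle⟩ := ih hp
    exact ⟨h', hp', hle.trans (time_le_time_succHist ht _)⟩

lemma time_nonneg_of_path {m : ℕ} {h : Hist n m} (hh : path lam σ x₀ ω m = some h) :
    0 ≤ h.time := by
  obtain ⟨h', hp, hle⟩ := exists_path_of_le (Nat.zero_le m) hh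
  exact le_trans le_rfl hle

lemma stock_of_path : ∀ {m : ℕ} {h : Hist n m}, path lam σ x₀ ω m = some h →
    h.stock = stockSeq x₀ ω m
  | 0, h, hh => by
    rw [path, Option.some_inj] at hh
    subst hh
    simp [Hist.stock, stockSeq]
  | m + 1, h, hh => by
    obtain ⟨h1, hp, _, rfl⟩ := path_succ_eq_some hh
    rw [stock_succHist, stock_of_path hp, stockSeq, stockSeq, Finset.sum_range_succ, add_assoc]

lemma increment_eq_size {t : ℝ} {m : ℕ} {h : Hist n (m + 1)}
    (hh : path lam σ x₀ ω (m + 1) = some h) (ht : h.time ≤ t) :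
    increment lam σ x₀ ω t m = (ω m).2 := by
  obtain ⟨h1, _, _, rfl⟩ := path_succ_eq_some hh
  rw [increment, hh, Option.elim_some, if_pos ht]
  simp [succHist]

lemma increment_mem_Icc (hz : ∀ m, 0 < (ω m).2) (t : ℝ) (m : ℕ) :
    increment lam σ x₀ ω t m ∈ Icc 0 (ω m).2 := by
  by_cases hm : ∀ h, path lam σ x₀ ω (m + 1) = some h → t < h.time
  · rw [increment_eq_zero hm]
    exact ⟨le_rfl, (hz m).le⟩
  · push Not at hm
    obtain ⟨h, hh, ht⟩ := hm
    rw [increment_eq_size hh ht]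
    exact ⟨(hz m).le, le_rfl⟩

lemma le_stockAt (hz : ∀ m, 0 < (ω m).2) (t : ℝ) : x₀ ≤ stockAt lam σ x₀ ω t :=
  le_add_of_nonneg_right (tsum_nonneg fun m => (increment_mem_Icc hz t m).1)

/-- Non-explosion is needed here: it makes the sum that defines the stock at time `t` finite. -/
lemma stockSeq_le_stockAt (hz : ∀ m, 0 < (ω m).2) (hne : NonExplosive lam σ x₀ ω) {m : ℕ}
    {h : Hist n m} (hh : path lam σ x₀ ω m = some h) {t : ℝ} (ht : h.time ≤ t) :
    stockSeq x₀ ω m ≤ stockAt lam σ x₀ ω t := by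
  have hsum : Summable (increment lam σ x₀ ω t) := by
    obtain ⟨M, hM⟩ := hne t
    refine summable_of_ne_finset_zero (s := Finset.range M) fun j hj => ?_
    refine increment_eq_zero fun h' hh' => hM (j + 1) ?_ h' hh'
    have := Finset.mem_range.not.1 hj
    omega
  have heq : ∑ j ∈ Finset.range m, (ω j).2
      = ∑ j ∈ Finset.range m, increment lam σ x₀ ω t j := by
    refine Finset.sum_congr rfl fun j hj => ?_
    obtain ⟨h', hh', hle⟩ := exists_path_of_le (Finset.mem_range.1 hj) hh
    exact (increment_eq_size hh' (hle.trans ht)).symm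
  rw [stockSeq, heq]
  exact add_le_add_right (hsum.sum_le_tsum _ fun j _ => (increment_mem_Icc hz t j).1) x₀

lemma stockAt_le_stockSeq (hz : ∀ m, 0 < (ω m).2) {k : ℕ} {h : Hist n (k + 1)}
    (hh : path lam σ x₀ ω (k + 1) = some h) {t : ℝ} (ht : t < h.time) :
    stockAt lam σ x₀ ω t ≤ stockSeq x₀ ω k := by
  have heq : ∑' j, increment lam σ x₀ ω t j
      = ∑ j ∈ Finset.range k, increment lam σ x₀ ω t j := by
    refine tsum_eq_sum fun j hj => increment_eq_zero fun h' hh' => ?_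
    have hkj : k + 1 ≤ j + 1 := by
      have := Finset.mem_range.not.1 hj
      omega
    obtain ⟨h1, hp, hle⟩ := exists_path_of_le hkj hh'
    rw [hh, Option.some_inj] at hp
    subst hp
    exact ht.trans_le hle
  have h1 : stockAt lam σ x₀ ω t = x₀ + ∑' j, increment lam σ x₀ ω t j := rfl
  rw [h1, heq, stockSeq]
  exact add_le_add_right (Finset.sum_le_sum fun j _ => (increment_mem_Icc hz t j).2) x₀

/-- With positive effort, held constant until the next innovation, an innovation occurs. -/
lemma exists_path_succ (hl : 0 < lam) (α : MarkovStrategy) {m : ℕ} {h : Hist n m}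
    (hh : path lam (α.profile n) x₀ ω m = some h) (hα : 0 < α h.stock) :
    ∃ h', path lam (α.profile n) x₀ ω (m + 1) = some h' := by
  have hne : nextTime lam (α.profile n) h (ω m).1 ≠ ⊤ := by
    set e := (ω m).1 0
    have hpos : 0 < lam * α h.stock := mul_pos hl hα
    set t := h.time + |e| / (lam * α h.stock) with ht
    have h1 : agentArrival lam (α.profile n) h (ω m).1 0 ≤ (t : EReal) := by
      refine (arrival_le_iff hl (((α.profile n) 0).measurable_effort h)
        (((α.profile n) 0).effort_mem m h) t).2 ⟨le_add_of_nonneg_right (by positivity), ?_⟩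
      have h2 : ∫ r in h.time..t, lam * ((α.profile n) 0).effort m h r
          = ∫ _r in h.time..t, lam * α h.stock := rfl
      rw [h2, intervalIntegral.integral_const, ht, add_sub_cancel_left, smul_eq_mul,
        div_mul_cancel₀ _ hpos.ne']
      exact le_abs_self _
    exact ne_top_of_le_ne_top (EReal.coe_ne_top t) ((iInf_le _ 0).trans h1)
  exact ⟨_, by rw [path, hh, Option.bind_some, nextHist_eq_some hne]⟩

end Deterministic

end SamplePaths

/-! ### Efficient effort -/

section Efficient

variable {n : ℕ} {u : ℝ → ℝ → ℝ} {lam : ℝ} {F : Measure ℝ} [IsProbabilityMeasure F]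

/-- From a nonnegative initial stock, values of the flow payoff outside `[0,1] × [0,∞)` do not
matter. -/
lemma welfare_extendFlow [NeZero n] (hpos : ∀ᵐ z ∂F, 0 < z) (u : ℝ → ℝ → ℝ) (lam : ℝ)
    (σ : Fin n → Strategy n) {x₀ : ℝ} (hx₀ : 0 ≤ x₀) :
    welfare u lam F σ x₀ = welfare (extendFlow u) lam F σ x₀ := by
  rw [welfare, welfare]
  congr 1
  refine Finset.sum_congr rfl fun i _ => ?_
  rw [payoff, payoff]
  refine tsum_congr fun m => integral_congr_ae ?_
  filter_upwards [ae_forall_size n hpos] with ω hω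
  rw [stagePayoff_eq_elim, stagePayoff_eq_elim]
  cases hh : path lam σ x₀ ω m with
  | none => rfl
  | some h =>
    have hX : 0 ≤ h.stock := by
      rw [stock_of_path hh]
      exact add_nonneg hx₀ (Finset.sum_nonneg fun j _ => (hω j).le)
    simp only [Option.elim_some, stageValue]
    refine integral_congr_ae (Eventually.of_forall fun t => ?_)
    simp only
    rw [extendFlow_eq u ((σ i).effort_mem m h t) hX]

/-- The efficient effort is the smallest maximiser in the Hamilton-Jacobi-Bellman equation; the
sign of effort is decided by comparing the marginal social value with the marginal cost. -/
theorem exists_efficientEffort (hyp : StandingAssumptions n u lam F) :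
    ∃ α : MarkovStrategy, IsEfficientEffort n u lam F α ∧
      (∀ x, 0 ≤ x → cost₁ u 0 x < socialValue n u lam F x → 0 < α x) ∧
      (∀ x, 0 ≤ x → socialValue n u lam F x ≤ cost₁ u 0 x → α x = 0) := by
  have : NeZero n := ⟨by have := hyp.two_le; omega⟩
  have hl := hyp.lam_pos
  have hF := hyp.size_integrable
  have hpos := hyp.ae_pos
  have hln : 0 ≤ lam * n := by positivity
  obtain ⟨K, hu⟩ := hyp.exists_regular
  obtain ⟨v, hv⟩ := hu.exists_solution hF hpos hl n
  obtain ⟨B, hB⟩ := hv.bounded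
  set C₀ := |u 1 0| + |u 0 0| + (K : ℝ) with hC₀
  have hK : 0 ≤ (K : ℝ) := K.2
  have hC₀0 : 0 ≤ C₀ := by positivity
  have hB0 : 0 ≤ B := by linarith [hB 0, hv.le 0]
  have hflow : FlowBound (extendFlow u) (C₀ + B) := by
    refine ⟨hu.cont, fun a ha x => (hyp.abs_extendFlow_le hu ha x).trans ?_⟩
    exact mul_le_mul_of_nonneg_right (by linarith) (by positivity)
  have hval : ValueBound v (C₀ + B) := by
    refine ⟨hv.cont.measurable, fun x => ?_⟩
    have h1 := abs_le.1 (hyp.abs_extendFlow_le hu zero_mem_unit x)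
    have h2 := abs_nonneg x
    have h3 := hv.le x
    have h4 := hB x
    have h5 : (C₀ + B) * (1 + |x|) = C₀ * (1 + |x|) + B + B * |x| := by ring
    have h6 : 0 ≤ B * |x| := by positivity
    rw [abs_le, h5]
    constructor <;> linarith [h1.1, h1.2]
  set G : ℝ → ℝ → ℝ := fun x a =>
    extendFlow u a x + a * lam * n * (expAfter F v x - v x) with hG
  have hGc : Continuous (Function.uncurry G) := by
    have h1 : Continuous fun p : ℝ × ℝ => extendFlow u p.2 p.1 :=
      hu.cont.comp (continuous_snd.prodMk continuous_fst)
    have h2 : Continuous fun p : ℝ × ℝ => expAfter F v p.1 - v p.1 :=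
      (hv.cont_expAfter.sub hv.cont).comp continuous_fst
    exact h1.add (((continuous_snd.mul_const lam).mul_const (n : ℝ)).mul h2)
  obtain ⟨α, hαm, hα⟩ := exists_measurable_isLeast_isMaxOn hGc
  have hαG : ∀ x, G x (α x) = v x := by
    intro x
    obtain ⟨a, ha, he⟩ := hv.attained x
    refine le_antisymm (hv.super x _ (hα x).1.1) ?_
    rw [← he]
    exact (hα x).1.2 ha
  set A : MarkovStrategy := ⟨α, fun x => (hα x).1.1, hαm⟩ with hA
  have hle : ∀ (σ : Fin n → Strategy n) x₀, 0 ≤ x₀ → welfare u lam F σ x₀ ≤ v x₀ := by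
    intro σ x₀ hx₀
    rw [welfare_extendFlow hpos u lam σ hx₀]
    exact welfare_le_of_supersolution hflow hval hF hl hv.super σ x₀
  have heq : ∀ x₀, 0 ≤ x₀ → welfare u lam F (A.profile n) x₀ = v x₀ := by
    intro x₀ hx₀
    rw [welfare_extendFlow hpos u lam _ hx₀]
    exact welfare_eq_of_solution hflow hval hF hl (fun m h i t => hαG h.stock) x₀
  have hgreat : ∀ x₀, 0 ≤ x₀ → IsGreatest (range fun σ : Fin n → Strategy n =>
      welfare u lam F σ x₀) (welfare u lam F (A.profile n) x₀) := by
    intro x₀ hx₀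
    refine ⟨⟨_, rfl⟩, ?_⟩
    rintro _ ⟨σ, rfl⟩
    exact (hle σ x₀ hx₀).trans (heq x₀ hx₀).ge
  have hmax : ∀ x₀, 0 ≤ x₀ → maxWelfare n u lam F x₀ = v x₀ := fun x₀ hx₀ =>
    (hgreat x₀ hx₀).csSup_eq.trans (heq x₀ hx₀)
  have hexp : ∀ x, 0 ≤ x → expAfter F (maxWelfare n u lam F) x = expAfter F v x := by
    intro x hx
    refine integral_congr_ae ?_
    filter_upwards [hpos] with z hz
    exact hmax _ (by linarith)
  have hsmall : ∀ x, 0 ≤ x → IsLeast (efficientEffortSet n u lam F x) (A x) := by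
    intro x hx
    have hset : efficientEffortSet n u lam F x
        = {a | a ∈ Icc (0 : ℝ) 1 ∧ IsMaxOn (G x) (Icc 0 1) a} := by
      ext a
      rw [efficientEffortSet, mem_ofPred_eq, mem_ofPred_eq, hexp x hx, hmax x hx]
      refine and_congr_right fun ha => ?_
      rw [isMaxOn_iff, isMaxOn_iff]
      refine forall₂_congr fun a' ha' => ?_
      simp only [hG]
      rw [extendFlow_eq u ha hx, extendFlow_eq u ha' hx, cost, cost]
      constructor <;> intro h <;> linarith
    rw [hset]
    exact hα x
  refine ⟨A, ⟨hgreat, hsmall⟩, fun x hx hlt => ?_, fun x hx hxs => ?_⟩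
  · -- If no effort were efficient at `x`, then `v x` would be the benefit at `x`, and the gain from
    -- an innovation would be at least the one that the marginal social value accounts for.
    refine lt_of_le_of_ne (hα x).1.1.1 fun h0 => ?_
    have hv0 : v x = extendFlow u 0 x := by
      have h1 : α x = 0 := h0.symm
      rw [← hαG x, hG, h1]
      simp
    have hmono : expAfter F (extendFlow u 0) x ≤ expAfter F v x :=
      integral_mono (hu.integrable_benefit hF x) (hv.integrable x) fun z => hv.le _
    refine absurd ((hyp.le_cost₁_iff hx _).2 fun a ha => ?_) (not_le.2 hlt)
    have h1 := hv.super x a ha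
    rw [hyp.socialValue_eq hx]
    rw [hv0, extendFlow_eq u ha hx] at h1
    have h2 : a * (lam * n) * expAfter F (extendFlow u 0) x ≤ a * (lam * n) * expAfter F v x :=
      mul_le_mul_of_nonneg_left hmono (mul_nonneg ha.1 hln)
    have h3 : cost u a x = extendFlow u 0 x - u a x := by
      rw [cost, extendFlow_eq u zero_mem_unit hx]
    rw [h3]
    linarith
  · have hvx : v x = extendFlow u 0 x := by
      refine hv.eq_benefit hu hF hpos hl (xs := x) (fun y hy a ha => ?_) le_rfl
      have hy0 := hx.trans hy
      have h1 := (hyp.le_cost₁_iff hy0 _).1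
        (hyp.socialValue_le_cost₁_of_le hx hy hxs) a ha
      rw [hyp.socialValue_eq hy0] at h1
      rw [extendFlow_eq u ha hy0]
      have h3 : cost u a y = extendFlow u 0 y - u a y := by
        rw [cost, extendFlow_eq u zero_mem_unit hy0]
      rw [h3] at h1
      linarith
    refine le_antisymm ((hα x).2 ⟨zero_mem_unit, fun a ha => ?_⟩) (hα x).1.1.1
    have h1 : G x 0 = v x := by
      rw [hG, hvx]
      simp
    rw [mem_ofPred_eq, h1]
    exact hv.super x a ha

end Efficient

/-! ### The stock under efficient effort -/

section Dynamics

variable {n : ℕ} [NeZero n] {lam : ℝ} {α : MarkovStrategy} {x₀ : ℝ} {ω : Noise n}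

/-- If effort is positive below `xs`, then innovations keep occurring until the stock exceeds `xs`,
and the threshold is crossed at the time of the first innovation that lifts the stock above it. -/
lemma exists_isLeast_crossing (hl : 0 < lam) {xs : ℝ} (hx₀ : 0 ≤ x₀) (hxs : x₀ < xs)
    (hα : ∀ x, 0 ≤ x → x < xs → 0 < α x) (hz : ∀ m, 0 < (ω m).2)
    (hsum : Tendsto (fun M => ∑ j ∈ Finset.range M, (ω j).2) atTop atTop)
    (hne : NonExplosive lam (α.profile n) x₀ ω) :
    ∃ τ : ℝ, IsLeast {t : ℝ | 0 ≤ t ∧ xs ≤ stockAt lam (α.profile n) x₀ ω t} τ ∧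
      (∀ t : ℝ, 0 ≤ t → t < τ → stockAt lam (α.profile n) x₀ ω t < xs) ∧
      (∀ t : ℝ, τ ≤ t → xs ≤ stockAt lam (α.profile n) x₀ ω t) := by
  classical
  have hex : ∃ m, xs ≤ stockSeq x₀ ω m := by
    obtain ⟨m, hm⟩ := (hsum.eventually_ge_atTop (xs - x₀)).exists
    exact ⟨m, by rw [stockSeq]; linarith⟩
  have hmin : ∀ m, m < Nat.find hex → stockSeq x₀ ω m < xs := fun m hm =>
    not_le.1 (Nat.find_min hex hm)
  obtain ⟨k, hk⟩ : ∃ k, Nat.find hex = k + 1 := by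
    refine Nat.exists_eq_succ_of_ne_zero fun h0 => ?_
    have := Nat.find_spec hex
    rw [h0, stockSeq] at this
    simp at this
    linarith
  have hpath : ∀ m, m ≤ Nat.find hex → ∃ h, path lam (α.profile n) x₀ ω m = some h := by
    intro m
    induction m with
    | zero => exact fun _ => ⟨_, rfl⟩
    | succ m ih =>
      intro hm
      obtain ⟨h, hh⟩ := ih (by omega)
      refine exists_path_succ hl α hh (hα _ ?_ ?_)
      · rw [stock_of_path hh]
        exact add_nonneg hx₀ (Finset.sum_nonneg fun j _ => (hz j).le)
      · rw [stock_of_path hh]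
        exact hmin m (by omega)
  have hspec := Nat.find_spec hex
  rw [hk] at hspec hpath hmin
  obtain ⟨h, hh⟩ := hpath (k + 1) le_rfl
  have hbelow : ∀ t, t < h.time → stockAt lam (α.profile n) x₀ ω t < xs := fun t ht =>
    (stockAt_le_stockSeq hz hh ht).trans_lt (hmin k (Nat.lt_succ_self k))
  have habove : ∀ t, h.time ≤ t → xs ≤ stockAt lam (α.profile n) x₀ ω t := fun t ht =>
    hspec.trans (stockSeq_le_stockAt hz hne hh ht)
  refine ⟨h.time, ⟨⟨time_nonneg_of_path hh, habove _ le_rfl⟩, fun t ht => ?_⟩,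
    fun t _ ht => hbelow t ht, habove⟩
  exact not_lt.1 fun hlt => absurd ht.2 (not_le.2 (hbelow t hlt))

lemma tendsto_stockAt_atTop (hl : 0 < lam) (hx₀ : 0 ≤ x₀) (hα : ∀ x, 0 ≤ x → 0 < α x)
    (hz : ∀ m, 0 < (ω m).2)
    (hsum : Tendsto (fun M => ∑ j ∈ Finset.range M, (ω j).2) atTop atTop)
    (hne : NonExplosive lam (α.profile n) x₀ ω) :
    Tendsto (fun t => stockAt lam (α.profile n) x₀ ω t) atTop atTop := by
  have hpath : ∀ m, ∃ h, path lam (α.profile n) x₀ ω m = some h := by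
    intro m
    induction m with
    | zero => exact ⟨_, rfl⟩
    | succ m ih =>
      obtain ⟨h, hh⟩ := ih
      refine exists_path_succ hl α hh (hα _ ?_)
      rw [stock_of_path hh]
      exact add_nonneg hx₀ (Finset.sum_nonneg fun j _ => (hz j).le)
  refine tendsto_atTop.2 fun R => ?_
  obtain ⟨m, hm⟩ := (hsum.eventually_ge_atTop (R - x₀)).exists
  obtain ⟨h, hh⟩ := hpath m
  filter_upwards [eventually_ge_atTop h.time] with t ht
  refine le_trans ?_ (stockSeq_le_stockAt hz hne hh ht)
  rw [stockSeq]
  linarith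

end Dynamics

end InnovationGame

theorem mainTheorem6 (n : ℕ) (u : ℝ → ℝ → ℝ) (lam : ℝ) (F : Measure ℝ) [IsProbabilityMeasure F]
    (hyp : StandingAssumptions n u lam F) :
    ∃ α : MarkovStrategy, IsEfficientEffort n u lam F α ∧
      ((∃ x : ℝ, 0 ≤ x ∧ socialValue n u lam F x ≤ cost₁ u 0 x) →
        ∃ xs : ℝ, IsLeast {x : ℝ | 0 ≤ x ∧ socialValue n u lam F x ≤ cost₁ u 0 x} xs ∧
          (∀ x : ℝ, xs ≤ x → α x = 0) ∧
          (∀ x₀ : ℝ, xs ≤ x₀ → ∀ᵐ ω ∂(noiseLaw n F), ∀ t : ℝ, 0 ≤ t →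
            α (stockAt lam (α.profile n) x₀ ω t) = 0) ∧
          (∀ x₀ : ℝ, 0 ≤ x₀ → x₀ < xs → ∀ᵐ ω ∂(noiseLaw n F), ∃ τ : ℝ,
            IsLeast {t : ℝ | 0 ≤ t ∧ xs ≤ stockAt lam (α.profile n) x₀ ω t} τ ∧
            (∀ t : ℝ, 0 ≤ t → t < τ → 0 < α (stockAt lam (α.profile n) x₀ ω t)) ∧
            (∀ t : ℝ, τ ≤ t → α (stockAt lam (α.profile n) x₀ ω t) = 0))) ∧
      ((∀ x : ℝ, 0 ≤ x → cost₁ u 0 x < socialValue n u lam F x) →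
        ∀ x₀ : ℝ, 0 ≤ x₀ → ∀ᵐ ω ∂(noiseLaw n F),
          (∀ t : ℝ, 0 ≤ t → 0 < α (stockAt lam (α.profile n) x₀ ω t)) ∧
          Tendsto (fun t : ℝ => stockAt lam (α.profile n) x₀ ω t) atTop atTop) := by
  have : NeZero n := ⟨by have := hyp.two_le; omega⟩
  have hF := hyp.size_integrable
  have hpos := hyp.ae_pos
  have hl := hyp.lam_pos
  obtain ⟨α, hα, hαpos, hαzero⟩ := exists_efficientEffort hyp
  refine ⟨α, hα, fun hex => ?_, fun hgt x₀ hx₀ => ?_⟩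
  · have hleast := hyp.isClosed_socialValue_le.isLeast_csInf hex ⟨0, fun x hx => hx.1⟩
    set xs := sInf {x : ℝ | 0 ≤ x ∧ socialValue n u lam F x ≤ cost₁ u 0 x}
    have hzero : ∀ x, xs ≤ x → α x = 0 := fun x hx =>
      hαzero x (hleast.1.1.trans hx) (hyp.socialValue_le_cost₁_of_le hleast.1.1 hx hleast.1.2)
    have hposx : ∀ x, 0 ≤ x → x < xs → 0 < α x := fun x hx hlt =>
      hαpos x hx (not_le.1 fun hle => absurd (hleast.2 ⟨hx, hle⟩) (not_le.2 hlt))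
    refine ⟨xs, hleast, hzero, fun x₀ hx₀ => ?_, fun x₀ hx₀ hlt => ?_⟩
    · filter_upwards [ae_forall_size n hpos] with ω hω t _
      exact hzero _ (hx₀.trans (le_stockAt hω t))
    · filter_upwards [ae_forall_size n hpos, ae_tendsto_sum_size n hF hpos,
        ae_nonExplosive hF hl (α.profile n) x₀] with ω hω hsum hne
      obtain ⟨τ, hτ, hbelow, habove⟩ := exists_isLeast_crossing hl hx₀ hlt hposx hω hsum hne
      exact ⟨τ, hτ, fun t h0 ht => hposx _ (hx₀.trans (le_stockAt hω t)) (hbelow t h0 ht),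
        fun t ht => hzero _ (habove t ht)⟩
  · have hposx : ∀ x, 0 ≤ x → 0 < α x := fun x hx => hαpos x hx (hgt x hx)
    filter_upwards [ae_forall_size n hpos, ae_tendsto_sum_size n hF hpos,
      ae_nonExplosive hF hl (α.profile n) x₀] with ω hω hsum hne
    exact ⟨fun t _ => hposx _ (hx₀.trans (le_stockAt hω t)),
      tendsto_stockAt_atTop hl hx₀ hposx hω hsum hne⟩
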